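/- Let $\mathcal G=(\mathcal V,\mathcal E)$, $\mathcal E=\{e_1,\dots,e_m\}$, be a finite directed graph whose underlying undirected graph is a tree. Pipe $e_k$ is directed from its start node $0_k$ to its end node $l_k$, is identified with the interval $[0,L_k]$ with $L_k>0$ (the endpoints $0$ and $L_k$ corresponding to $0_k$ and $l_k$), and has diameter $D_k>0$; let $c>0$ be the sound speed. Put $\xi_k(v)=-1$ if $v=0_k$, $\xi_k(v)=1$ if $v=l_k$, and $\xi_k(v)=0$ otherwise. A node is *interior* if it meets more than one pipe and a *boundary* node otherwise; a boundary node $v$ is an *entry* node if $\xi_k(v)=-1$ for some $k$, and an *exit* node if $\xi_k(v)=1$ for some $k$. Let $\mathbb L^2(\Omega)=\prod_{k=1}^m L^2(0,L_k)\times L^2(0,L_k)$ be the real Hilbert space of families $\mathbf u=(p^k,q^k)_{k}$ with the norm $$\|\mathbf u\|^2=\sum_{k=1}^m D_k^2\left(\|p^k\|_{L^2(0,L_k)}^2+c^2\|q^k\|_{L^2(0,L_k)}^2\right)$$ and the corresponding inner product $(\cdot,\cdot)$. Let $\mathbb A=\operatorname{diag}(\mathbf A_1,\dots,\mathbf A_m)$,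 where $$\mathbf A_k=\begin{bmatrix}0&-c^2\partial_x\\-\partial_x&0\end{bmatrix},\qquad\text{i.e. } \mathbb A(p^k,q^k)_k=(-c^2\partial_xq^k,-\partial_xp^k)_k$$ with $\partial_x$ the weak derivative. Its domain $\mathcal D(\mathbb A)$ consists of all $(p^k,q^k)_k$ with $p^k,q^k\in H^1(0,L_k)$ for all $k$ whose continuous representatives on $[0,L_k]$ satisfy: 1. $p^k(0)=0$ for every $k$ such that $0_k$ is an entry node; 2. $q^k(L_k)=0$ for every $k$ such that $l_k$ is an exit node; 3. at every interior node $v$: $p^j(v)=p^k(v)$ whenever $\xi_j(v)\ne0$ and $\xi_k(v)\neq 0$, and $\sum_{k=1}^m\xi_k(v)D_k^2q^k(v)=0$, where, for $\xi_k(v)\ne0$, the value at $v$ of a function on pipe $k$ is its value at the endpoint corresponding to $v$. Then: * $\mathbb A$ is maximal dissipative in $\mathbb L^2(\Omega)$: $(\mathbb A\mathbf u,\mathbf u)\le0$ for all $\mathbf u\in\mathcal D(\mathbb A)$, and for every $\mathbf f\in\mathbb L^2(\Omega)$ there is $\mathbf u\in\mathcal D(\mathbb A)$ with $\mathbf u-\mathbb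 A\mathbf u=\mathbf f$; * $\mathbb A$ is skew-adjoint: it is densely defined and $\mathbb A^*=-\mathbb A$ (with equality of domains); * $\mathbb A$ is the infinitesimal generator of a $C_0$-group $(T(t))_{t\in\mathbb R}$ of isometries of $\mathbb L^2(\Omega)$. -/

import Mathlib

open MeasureTheory Set Filter Topology
open scoped ContDiff InnerProductSpace LinearPMap

noncomputable section

/-! ### Weighted `L²` and first order Sobolev spaces on a bounded interval -/

/-- `L²(0, ℓ)` (real valued) with the norm `‖u‖² = w * ∫₀^ℓ |u|²`, for a weight `w > 0`. -/
abbrev WeightedL2 (ℓ w : ℝ) : Type :=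
  Lp ℝ 2 (ENNReal.ofReal w • (volume.restrict (Ioo (0 : ℝ) ℓ)))

/-- `g` is the distributional derivative of `u` on `(0, ℓ)`. -/
def HasWeakDeriv (ℓ : ℝ) (u g : ℝ → ℝ) : Prop :=
  ∀ φ : ℝ → ℝ, ContDiff ℝ ∞ φ → HasCompactSupport φ → tsupport φ ⊆ Ioo (0 : ℝ) ℓ →
    ∫ x in Ioo (0 : ℝ) ℓ, u x * deriv φ x = -∫ x in Ioo (0 : ℝ) ℓ, g x * φ x

/-- `f` is a continuous representative of `u` on the closed interval `[0, ℓ]`. For `ℓ > 0` its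
values on `[0, ℓ]`, in particular the two endpoint values, are determined by the class of `u`. -/
def IsContRep (ℓ : ℝ) (u f : ℝ → ℝ) : Prop :=
  ContinuousOn f (Icc (0 : ℝ) ℓ) ∧ u =ᵐ[volume.restrict (Ioo (0 : ℝ) ℓ)] f

theorem IsContRep.congr {ℓ : ℝ} {u v f : ℝ → ℝ} (h : IsContRep ℓ u f)
    (huv : v =ᵐ[volume.restrict (Ioo (0 : ℝ) ℓ)] u) : IsContRep ℓ v f :=
  ⟨h.1, huv.trans h.2⟩

theorem ae_of_ae_weighted {ℓ w : ℝ} (hw : 0 < w) {p : ℝ → Prop}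
    (h : ∀ᵐ x ∂(ENNReal.ofReal w • (volume.restrict (Ioo (0 : ℝ) ℓ))), p x) :
    ∀ᵐ x ∂(volume.restrict (Ioo (0 : ℝ) ℓ)), p x := by
  rwa [Measure.ae_ennreal_smul_measure_eq (ENNReal.ofReal_pos.2 hw).ne'] at h

theorem HasWeakDeriv.congr {ℓ : ℝ} {u v g : ℝ → ℝ} (h : HasWeakDeriv ℓ u g)
    (huv : v =ᵐ[volume.restrict (Ioo (0 : ℝ) ℓ)] u) : HasWeakDeriv ℓ v g := by
  intro φ h1 h2 h3
  rw [← h φ h1 h2 h3]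
  refine integral_congr_ae ?_
  filter_upwards [huv] with x hx
  rw [hx]

theorem integrable_mul_test {ℓ : ℝ} {u φ : ℝ → ℝ}
    (hu : MemLp u 2 (volume.restrict (Ioo (0 : ℝ) ℓ))) (hφ : Continuous φ)
    (hc : HasCompactSupport φ) :
    Integrable (fun x => u x * φ x) (volume.restrict (Ioo (0 : ℝ) ℓ)) :=
  hu.integrable_mul (q := 2) ((hφ.memLp_of_hasCompactSupport hc).restrict _)

theorem HasWeakDeriv.add {ℓ : ℝ} {u v g h : ℝ → ℝ}
    (mu : MemLp u 2 (volume.restrict (Ioo (0 : ℝ) ℓ)))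
    (mv : MemLp v 2 (volume.restrict (Ioo (0 : ℝ) ℓ)))
    (mg : MemLp g 2 (volume.restrict (Ioo (0 : ℝ) ℓ)))
    (mh : MemLp h 2 (volume.restrict (Ioo (0 : ℝ) ℓ)))
    (hu : HasWeakDeriv ℓ u g) (hv : HasWeakDeriv ℓ v h) :
    HasWeakDeriv ℓ (u + v) (g + h) := by
  intro φ h1 h2 h3
  have c1 : Continuous (deriv φ) := h1.continuous_deriv (by simp)
  simp only [Pi.add_apply, add_mul]
  rw [integral_add (integrable_mul_test mu c1 h2.deriv) (integrable_mul_test mv c1 h2.deriv),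
    integral_add (integrable_mul_test mg h1.continuous h2)
      (integrable_mul_test mh h1.continuous h2), hu φ h1 h2 h3, hv φ h1 h2 h3]
  ring

theorem HasWeakDeriv.smul {ℓ : ℝ} {u g : ℝ → ℝ} (a : ℝ) (hu : HasWeakDeriv ℓ u g) :
    HasWeakDeriv ℓ (a • u) (a • g) := by
  intro φ h1 h2 h3
  simp only [Pi.smul_apply, smul_eq_mul, mul_assoc]
  rw [integral_const_mul, integral_const_mul, hu φ h1 h2 h3]
  ring

theorem HasWeakDeriv.ae_eq {ℓ : ℝ} {u g h : ℝ → ℝ}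
    (mg : MemLp g 2 (volume.restrict (Ioo (0 : ℝ) ℓ)))
    (mh : MemLp h 2 (volume.restrict (Ioo (0 : ℝ) ℓ)))
    (hg : HasWeakDeriv ℓ u g) (hh : HasWeakDeriv ℓ u h) :
    g =ᵐ[volume.restrict (Ioo (0 : ℝ) ℓ)] h := by
  have key : ∀ᵐ x ∂(volume : Measure ℝ), x ∈ Ioo (0 : ℝ) ℓ → (g - h) x = 0 := by
    refine isOpen_Ioo.ae_eq_zero_of_integral_contDiff_smul_eq_zero ?_ ?_
    · have : Integrable (g - h) (volume.restrict (Ioo (0 : ℝ) ℓ)) :=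
        (mg.sub mh).integrable (by norm_num)
      exact IntegrableOn.locallyIntegrableOn this
    · intro φ h1 h2 h3
      have e : ∫ x in Ioo (0 : ℝ) ℓ, φ x • (g - h) x = 0 := by
        have e1 : ∀ x, φ x • (g - h) x = g x * φ x - h x * φ x := by
          intro x; simp only [Pi.sub_apply, smul_eq_mul]; ring
        simp only [e1]
        rw [integral_sub (integrable_mul_test mg h1.continuous h2)
          (integrable_mul_test mh h1.continuous h2)]
        have a := hg φ h1 h2 h3
        have b := hh φ h1 h2 h3
        linarith
      rw [← e]
      refine (setIntegral_eq_integral_of_forall_compl_eq_zero ?_).symm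
      intro x hx
      have : φ x = 0 := image_eq_zero_of_notMem_tsupport fun hx' => hx (h3 hx')
      simp [this]
  filter_upwards [(ae_restrict_iff' measurableSet_Ioo).2 key] with x hx
  exact sub_eq_zero.1 hx

theorem WeightedL2.memLp {ℓ w : ℝ} (hw : 0 < w) (u : WeightedL2 ℓ w) :
    MemLp (u : ℝ → ℝ) 2 (volume.restrict (Ioo (0 : ℝ) ℓ)) := by
  have h := (Lp.memLp u).smul_measure (c := (ENNReal.ofReal w)⁻¹) (by simpa using hw)
  rwa [smul_smul, ENNReal.inv_mul_cancel (by simpa using hw) ENNReal.ofReal_ne_top,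
    one_smul] at h

theorem WeightedL2.coeFn_add {ℓ w : ℝ} (hw : 0 < w) (u v : WeightedL2 ℓ w) :
    ((u + v : WeightedL2 ℓ w) : ℝ → ℝ) =ᵐ[volume.restrict (Ioo (0 : ℝ) ℓ)]
      (u : ℝ → ℝ) + (v : ℝ → ℝ) :=
  ae_of_ae_weighted hw (Lp.coeFn_add u v)

theorem WeightedL2.coeFn_smul {ℓ w : ℝ} (hw : 0 < w) (a : ℝ) (u : WeightedL2 ℓ w) :
    ((a • u : WeightedL2 ℓ w) : ℝ → ℝ) =ᵐ[volume.restrict (Ioo (0 : ℝ) ℓ)]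
      a • (u : ℝ → ℝ) :=
  ae_of_ae_weighted hw (Lp.coeFn_smul a u)

theorem WeightedL2.coeFn_zero {ℓ w : ℝ} (hw : 0 < w) :
    ((0 : WeightedL2 ℓ w) : ℝ → ℝ) =ᵐ[volume.restrict (Ioo (0 : ℝ) ℓ)] 0 :=
  ae_of_ae_weighted hw (Lp.coeFn_zero ℝ 2 _)

/-- The Sobolev space `H¹(0, ℓ)`, as a subspace of the weighted `L²(0, ℓ)`: the elements that have
a distributional derivative in `L²(0, ℓ)`. -/
def SobolevH1 (ℓ : ℝ) {w : ℝ} (hw : 0 < w) : Submodule ℝ (WeightedL2 ℓ w) where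
  carrier := {u | ∃ g : ℝ → ℝ, MemLp g 2 (volume.restrict (Ioo (0 : ℝ) ℓ)) ∧
    HasWeakDeriv ℓ u g}
  add_mem' := by
    rintro u v ⟨g, mg, hg⟩ ⟨h, mh, hh⟩
    exact ⟨g + h, mg.add mh, (HasWeakDeriv.add (WeightedL2.memLp hw u) (WeightedL2.memLp hw v)
      mg mh hg hh).congr (WeightedL2.coeFn_add hw u v)⟩
  zero_mem' := by
    refine ⟨0, MemLp.zero, HasWeakDeriv.congr (u := 0) ?_ (WeightedL2.coeFn_zero hw)⟩
    intro φ _ _ _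
    simp
  smul_mem' := by
    rintro a u ⟨g, mg, hg⟩
    exact ⟨a • g, mg.const_smul a, (hg.smul a).congr (WeightedL2.coeFn_smul hw a u)⟩

/-- The weak derivative `∂ₓ`, mapping the subspace `H¹(0, ℓ)` of one weighted `L²(0, ℓ)` to the
`L²(0, ℓ)` with a possibly different weight (the underlying functions are the same). -/
def weakDeriv (ℓ : ℝ) {w : ℝ} (hw : 0 < w) (w' : ℝ) : SobolevH1 ℓ hw →ₗ[ℝ] WeightedL2 ℓ w' where
  toFun u := (u.2.choose_spec.1.smul_measure (c := ENNReal.ofReal w') ENNReal.ofReal_ne_top).toLp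
    u.2.choose
  map_add' u v := by
    rw [← MemLp.toLp_add]
    refine MemLp.toLp_congr _ _ (Measure.ae_smul_measure ?_ _)
    have hu := u.2.choose_spec
    have hv := v.2.choose_spec
    have huv := (u + v).2.choose_spec
    exact HasWeakDeriv.ae_eq huv.1 (hu.1.add hv.1) huv.2
      ((HasWeakDeriv.add (WeightedL2.memLp hw u.1) (WeightedL2.memLp hw v.1)
        hu.1 hv.1 hu.2 hv.2).congr (WeightedL2.coeFn_add hw u.1 v.1))
  map_smul' a u := by
    rw [RingHom.id_apply, ← MemLp.toLp_const_smul]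
    refine MemLp.toLp_congr _ _ (Measure.ae_smul_measure ?_ _)
    have hu := u.2.choose_spec
    have hau := (a • u).2.choose_spec
    exact HasWeakDeriv.ae_eq hau.1 (hu.1.const_smul a) hau.2
      ((hu.2.smul a).congr (WeightedL2.coeFn_smul hw a u.1))

/-! ### Networks of pipes -/

/-- A finite directed graph with vertices `V` and edges (pipes) `E` whose underlying undirected
graph is a tree; pipe `k` is directed from `source k` to `target k` and has length `length k` and
diameter `diam k`; `c` is the speed of sound. -/
structure PipeNetwork (V E : Type*) where
  source : E → V
  target : E → V
  source_ne_target : ∀ k, source k ≠ target k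
  edge_injective : Function.Injective fun k => s(source k, target k)
  isTree : (SimpleGraph.fromEdgeSet (Set.range fun k => s(source k, target k))).IsTree
  length : E → ℝ
  length_pos : ∀ k, 0 < length k
  diam : E → ℝ
  diam_pos : ∀ k, 0 < diam k
  c : ℝ
  c_pos : 0 < c

namespace PipeNetwork

variable {V E : Type*} (N : PipeNetwork V E)

open scoped Classical in
/-- `-1` if `v` is the start of pipe `k`, `1` if it is the end of pipe `k`, and `0` otherwise. -/
def xi (k : E) (v : V) : ℝ :=
  if v = N.source k then -1 else if v = N.target k then 1 else 0

/-- `v` is an interior node: it meets more than one pipe. -/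
def IsInterior (v : V) : Prop := 1 < {k : E | N.xi k v ≠ 0}.ncard

/-- `v` is an entry node: a boundary node at which some pipe starts. -/
def IsEntry (v : V) : Prop := ¬ N.IsInterior v ∧ ∃ k, N.xi k v = -1

/-- `v` is an exit node: a boundary node at which some pipe ends. -/
def IsExit (v : V) : Prop := ¬ N.IsInterior v ∧ ∃ k, N.xi k v = 1

open scoped Classical in
/-- The value at the node `v` of a function `f` on the pipe `k`, for `v` an end node of `k`:
`f 0` if `v` is the start of the pipe and `f (length k)` if it is its end. -/
def nodeValue (f : ℝ → ℝ) (k : E) (v : V) : ℝ :=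
  if v = N.source k then f 0 else f (N.length k)

/-- The weight `D_k²` of the pressure component. -/
def pWeight (k : E) : ℝ := N.diam k ^ 2

/-- The weight `D_k² c²` of the flux component. -/
def qWeight (k : E) : ℝ := N.diam k ^ 2 * N.c ^ 2

theorem pWeight_pos (k : E) : 0 < N.pWeight k := pow_pos (N.diam_pos k) 2

theorem qWeight_pos (k : E) : 0 < N.qWeight k :=
  mul_pos (pow_pos (N.diam_pos k) 2) (pow_pos N.c_pos 2)

variable [Fintype E]

/-- The network state space of the families `((p_k, q_k))_k` with `p_k, q_k ∈ L²(0, L_k)`, a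
Hilbert space with the norm `‖u‖² = ∑ k, D_k² (‖p_k‖² + c² ‖q_k‖²)`. -/
abbrev StateSpace : Type _ :=
  PiLp 2 fun k : E =>
    WithLp 2 (WeightedL2 (N.length k) (N.pWeight k) × WeightedL2 (N.length k) (N.qWeight k))

variable {N} in
/-- The pressure component in pipe `k`. -/
def pressure (u : N.StateSpace) (k : E) : WeightedL2 (N.length k) (N.pWeight k) := (u k).fst

variable {N} in
/-- The flux component in pipe `k`. -/
def flux (u : N.StateSpace) (k : E) : WeightedL2 (N.length k) (N.qWeight k) := (u k).snd

/-- The node conditions on the (continuous representatives of the) pressures `p k` and fluxes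
`q k`: zero pressure at entry nodes, zero flux at exit nodes, and at interior nodes continuity of
the pressure and the Kirchhoff law. -/
structure NodeConditions (p q : E → ℝ → ℝ) : Prop where
  entry : ∀ k, N.IsEntry (N.source k) → p k 0 = 0
  exit : ∀ k, N.IsExit (N.target k) → q k (N.length k) = 0
  continuity : ∀ v, N.IsInterior v → ∀ j k, N.xi j v ≠ 0 → N.xi k v ≠ 0 →
    N.nodeValue (p j) j v = N.nodeValue (p k) k v
  kirchhoff : ∀ v, N.IsInterior v →
    ∑ k, N.xi k v * N.diam k ^ 2 * N.nodeValue (q k) k v = 0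

/-- The domain of the network wave operator: `H¹` in every pipe, with the continuous
representatives satisfying the node conditions. -/
def waveDomain : Submodule ℝ N.StateSpace where
  carrier := {u |
    (∀ k, pressure u k ∈ SobolevH1 (N.length k) (N.pWeight_pos k)) ∧
    (∀ k, flux u k ∈ SobolevH1 (N.length k) (N.qWeight_pos k)) ∧
    ∃ p q : E → ℝ → ℝ,
      (∀ k, IsContRep (N.length k) (pressure u k) (p k)) ∧
      (∀ k, IsContRep (N.length k) (flux u k) (q k)) ∧
      N.NodeConditions p q}
  add_mem' := by
    rintro u v ⟨hu1, hu2, p, q, hp, hq, h⟩ ⟨hv1, hv2, p', q', hp', hq', h'⟩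
    refine ⟨fun k => add_mem (hu1 k) (hv1 k), fun k => add_mem (hu2 k) (hv2 k),
      fun k => p k + p' k, fun k => q k + q' k, fun k => ?_, fun k => ?_, ?_, ?_, ?_, ?_⟩
    · exact ⟨(hp k).1.add (hp' k).1,
        (WeightedL2.coeFn_add (N.pWeight_pos k) _ _).trans ((hp k).2.add (hp' k).2)⟩
    · exact ⟨(hq k).1.add (hq' k).1,
        (WeightedL2.coeFn_add (N.qWeight_pos k) _ _).trans ((hq k).2.add (hq' k).2)⟩
    · intro k hk
      simp [h.entry k hk, h'.entry k hk]
    · intro k hk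
      simp [h.exit k hk, h'.exit k hk]
    · intro w hw j k hj hk
      have a := h.continuity w hw j k hj hk
      have b := h'.continuity w hw j k hj hk
      have e : ∀ (f g : ℝ → ℝ) i, N.nodeValue (f + g) i w
          = N.nodeValue f i w + N.nodeValue g i w := by
        intro f g i; unfold nodeValue; split_ifs <;> rfl
      rw [e, e, a, b]
    · intro w hw
      have a := h.kirchhoff w hw
      have b := h'.kirchhoff w hw
      have e : ∀ (f g : ℝ → ℝ) i, N.nodeValue (f + g) i w
          = N.nodeValue f i w + N.nodeValue g i w := by
        intro f g i; unfold nodeValue; split_ifs <;> rfl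
      simp only [e, mul_add, Finset.sum_add_distrib]
      rw [a, b, add_zero]
  zero_mem' := by
    refine ⟨fun k => zero_mem _, fun k => zero_mem _, fun _ => 0, fun _ => 0,
      fun k => ⟨continuousOn_const, WeightedL2.coeFn_zero (N.pWeight_pos k)⟩,
      fun k => ⟨continuousOn_const, WeightedL2.coeFn_zero (N.qWeight_pos k)⟩, ?_, ?_, ?_, ?_⟩
    · intro k _; rfl
    · intro k _; rfl
    · intro w _ j k _ _; simp [nodeValue]
    · intro w _; simp [nodeValue]
  smul_mem' := by
    rintro a u ⟨hu1, hu2, p, q, hp, hq, h⟩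
    have e : ∀ (f : ℝ → ℝ) i w, N.nodeValue (a • f) i w = a * N.nodeValue f i w := by
      intro f i w; unfold nodeValue; split_ifs <;> rfl
    refine ⟨fun k => Submodule.smul_mem _ a (hu1 k), fun k => Submodule.smul_mem _ a (hu2 k),
      fun k => a • p k, fun k => a • q k, fun k => ?_, fun k => ?_, ?_, ?_, ?_, ?_⟩
    · exact ⟨(hp k).1.const_smul a,
        (WeightedL2.coeFn_smul (N.pWeight_pos k) a _).trans ((hp k).2.const_smul a)⟩
    · exact ⟨(hq k).1.const_smul a,
        (WeightedL2.coeFn_smul (N.qWeight_pos k) a _).trans ((hq k).2.const_smul a)⟩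
    · intro k hk
      simp [h.entry k hk]
    · intro k hk
      simp [h.exit k hk]
    · intro w hw j k hj hk
      rw [e, e, h.continuity w hw j k hj hk]
    · intro w hw
      have b := h.kirchhoff w hw
      simp only [e, mul_left_comm _ a]
      rw [← Finset.mul_sum, b, mul_zero]

/-- The network wave operator `(p_k, q_k) ↦ (-c² ∂ₓ q_k, -∂ₓ p_k)`. -/
def waveOperator : N.StateSpace →ₗ.[ℝ] N.StateSpace where
  domain := N.waveDomain
  toFun :=
    { toFun := fun u => WithLp.toLp 2 fun k => WithLp.toLp 2
        (-(N.c ^ 2 • weakDeriv (N.length k) (N.qWeight_pos k) (N.pWeight k)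
            ⟨flux u.1 k, u.2.2.1 k⟩),
          -weakDeriv (N.length k) (N.pWeight_pos k) (N.qWeight k)
            ⟨pressure u.1 k, u.2.1 k⟩)
      map_add' := by
        intro u v
        ext1 k
        have e1 : (⟨flux (u + v).1 k, (u + v).2.2.1 k⟩ :
            SobolevH1 (N.length k) (N.qWeight_pos k))
            = ⟨flux u.1 k, u.2.2.1 k⟩ + ⟨flux v.1 k, v.2.2.1 k⟩ := rfl
        have e2 : (⟨pressure (u + v).1 k, (u + v).2.1 k⟩ :
            SobolevH1 (N.length k) (N.pWeight_pos k))
            = ⟨pressure u.1 k, u.2.1 k⟩ + ⟨pressure v.1 k, v.2.1 k⟩ := rfl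
        simp only [e1, e2, map_add, smul_add, neg_add]
        rfl
      map_smul' := by
        intro a u
        ext1 k
        have e1 : (⟨flux (a • u).1 k, (a • u).2.2.1 k⟩ :
            SobolevH1 (N.length k) (N.qWeight_pos k)) = a • ⟨flux u.1 k, u.2.2.1 k⟩ := rfl
        have e2 : (⟨pressure (a • u).1 k, (a • u).2.1 k⟩ :
            SobolevH1 (N.length k) (N.pWeight_pos k)) = a • ⟨pressure u.1 k, u.2.1 k⟩ := rfl
        simp only [e1, e2, map_smul, smul_comm (N.c ^ 2) a, ← smul_neg]
        rfl }

end PipeNetwork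

/-! ### Unbounded operators on a real Hilbert space -/

section Operators

variable {H : Type*} [NormedAddCommGroup H] [InnerProductSpace ℝ H]

/-- `A` is maximal dissipative: `⟪A u, u⟫ ≤ 0` on the domain, and `I - A` is onto. -/
def IsMaximalDissipative (A : H →ₗ.[ℝ] H) : Prop :=
  (∀ u : A.domain, ⟪A u, (u : H)⟫_ℝ ≤ 0) ∧ ∀ f : H, ∃ u : A.domain, (u : H) - A u = f

/-- `A` is skew-adjoint: densely defined with `A† = -A` (equality of domains included). -/
def IsSkewAdjointOperator [CompleteSpace H] (A : H →ₗ.[ℝ] H) : Prop :=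
  Dense (A.domain : Set H) ∧ A† = -A

/-- A strongly continuous one-parameter group of bounded operators. -/
structure IsC0Group (T : ℝ → H →L[ℝ] H) : Prop where
  map_zero : T 0 = ContinuousLinearMap.id ℝ H
  map_add : ∀ s t, T (s + t) = (T s).comp (T t)
  continuous : ∀ u, Continuous fun t => T t u

/-- `A` is the infinitesimal generator of `T`: the domain of `A` consists exactly of the `u` for
which `(T h u - u) / h` converges as `h → 0`, and the limit is `A u`. -/
def IsGenerator (A : H →ₗ.[ℝ] H) (T : ℝ → H →L[ℝ] H) : Prop :=
  ∀ u f : H, (u, f) ∈ A.graph ↔ Tendsto (fun h : ℝ => h⁻¹ • (T h u - u)) (𝓝[≠] 0) (𝓝 f)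

end Operators

end

/-! ### Weak derivatives on an interval -/

/-! The heart is skew-adjointness; the other two claims hold for every skew-adjoint operator `A`.

Skew-symmetry is Green's formula. Integration by parts in each pipe leaves endpoint terms
(`IsWeakImage.inner_add_inner`), and regrouping them by nodes gives, at each node, sums of products
of the pressure of one state with the flux of the other. The node conditions make each of these sums
vanish (`NodeConditions.sum_eq_zero`).

Conversely, the node conditions are a maximal choice with this property. Let `v` lie in the domain
of the adjoint. Test states supported inside one pipe show that `v` has weak derivatives in `L²`,
hence continuous representatives (`isWeakImage_of_forall_inner`). Testing next with affine functions
whose data live at a single node isolates the sum at that node (`sum_node_eq_zero`), and suitable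
data force every condition on `v` (`nodeConditions_of_forall_inner`). So the adjoint has no larger
domain.

For a skew-adjoint `A` one has `⟪A u, u⟫ = 0`, so `‖u - a A u‖² = ‖u‖² + a² ‖A u‖²`. For `a ≠ 0` the
range of `I - a A` is therefore closed, and by maximality its orthogonal complement is zero
(`exists_sub_smul_eq`); `a = 1` gives maximal dissipativity. The resolvents at `μ` and `-μ` combine
to bounded, commuting, skew Yosida approximations `B n` converging to `A` on its domain. The
isometries `exp (t • B n)` converge strongly to the group, whose generator is exactly `A`, again by
maximality. -/

theorem memLp_of_continuousOn_Icc {ℓ : ℝ} {f : ℝ → ℝ} (hf : ContinuousOn f (Icc 0 ℓ)) :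
    MemLp f 2 (volume.restrict (Ioo (0 : ℝ) ℓ)) := by
  obtain ⟨C, hC⟩ := isCompact_Icc.exists_bound_of_continuousOn hf
  refine MemLp.of_bound ((hf.mono Ioo_subset_Icc_self).aestronglyMeasurable measurableSet_Ioo) C ?_
  filter_upwards [ae_restrict_mem measurableSet_Ioo] with x hx
  exact hC x (Ioo_subset_Icc_self hx)

/-- Fundamental lemma of the calculus of variations, applied to the difference, which is integrable
because the interval is bounded. -/
theorem ae_eq_of_forall_integral_test_eq {ℓ : ℝ} {g h : ℝ → ℝ}
    (mg : MemLp g 2 (volume.restrict (Ioo (0 : ℝ) ℓ)))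
    (mh : MemLp h 2 (volume.restrict (Ioo (0 : ℝ) ℓ)))
    (H : ∀ φ : ℝ → ℝ, ContDiff ℝ ∞ φ → HasCompactSupport φ → tsupport φ ⊆ Ioo (0 : ℝ) ℓ →
      ∫ x in Ioo (0 : ℝ) ℓ, g x * φ x = ∫ x in Ioo (0 : ℝ) ℓ, h x * φ x) :
    g =ᵐ[volume.restrict (Ioo (0 : ℝ) ℓ)] h := by
  have key : ∀ᵐ x ∂(volume : Measure ℝ), x ∈ Ioo (0 : ℝ) ℓ → (g - h) x = 0 := by
    refine isOpen_Ioo.ae_eq_zero_of_integral_contDiff_smul_eq_zero ?_ ?_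
    · have : Integrable (g - h) (volume.restrict (Ioo (0 : ℝ) ℓ)) :=
        (mg.sub mh).integrable (by norm_num)
      exact IntegrableOn.locallyIntegrableOn this
    · intro φ h1 h2 h3
      have e : ∫ x in Ioo (0 : ℝ) ℓ, φ x • (g - h) x = 0 := by
        have e1 : ∀ x, φ x • (g - h) x = g x * φ x - h x * φ x := by
          intro x; simp only [Pi.sub_apply, smul_eq_mul]; ring
        simp only [e1]
        rw [integral_sub (integrable_mul_test mg h1.continuous h2)
          (integrable_mul_test mh h1.continuous h2), H φ h1 h2 h3, sub_self]
      rw [← e]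
      refine (setIntegral_eq_integral_of_forall_compl_eq_zero ?_).symm
      intro x hx
      have : φ x = 0 := image_eq_zero_of_notMem_tsupport fun hx' => hx (h3 hx')
      simp [this]
  filter_upwards [(ae_restrict_iff' measurableSet_Ioo).2 key] with x hx
  exact sub_eq_zero.1 hx

/-- The primitive from `0` vanishes to the left of the support, and to the right of it equals the
full integral, which is zero. -/
theorem exists_test_primitive {ℓ : ℝ} {χ : ℝ → ℝ} (hχ : ContDiff ℝ ∞ χ)
    (hc : HasCompactSupport χ) (hs : tsupport χ ⊆ Ioo (0 : ℝ) ℓ) (h0 : ∫ x, χ x = 0) :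
    ∃ ψ : ℝ → ℝ, ContDiff ℝ ∞ ψ ∧ HasCompactSupport ψ ∧ tsupport ψ ⊆ Ioo (0 : ℝ) ℓ ∧
      deriv ψ = χ := by
  have hd : ∀ x, HasDerivAt (fun x => ∫ t in (0 : ℝ)..x, χ t) (χ x) x := fun x =>
    (hχ.continuous.integral_hasStrictDerivAt 0 x).hasDerivAt
  have hde : deriv (fun x => ∫ t in (0 : ℝ)..x, χ t) = χ := funext fun x => (hd x).deriv
  have hsm : ContDiff ℝ ∞ (fun x => ∫ t in (0 : ℝ)..x, χ t) :=
    contDiff_infty_iff_deriv.2 ⟨fun x => (hd x).differentiableAt, by rwa [hde]⟩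
  rcases (tsupport χ).eq_empty_or_nonempty with he | hne
  · have hz : χ = 0 := by simpa [tsupport_eq_empty_iff] using he
    refine ⟨0, contDiff_const, HasCompactSupport.zero, by simp [tsupport], ?_⟩
    rw [hz]; ext x; simp
  -- The extreme points of the support satisfy `0 < a` and `b < ℓ`, so a primitive supported in `[a,
  -- b]` is again a test function on the open interval.
  obtain ⟨a, ha⟩ := hc.isCompact.exists_isLeast hne
  obtain ⟨b, hb⟩ := hc.isCompact.exists_isGreatest hne
  have hz : ∀ t, χ t ≠ 0 → a ≤ t ∧ t ≤ b := fun t ht =>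
    ⟨ha.2 (subset_tsupport _ ht), hb.2 (subset_tsupport _ ht)⟩
  have hsub : tsupport (fun x => ∫ t in (0 : ℝ)..x, χ t) ⊆ Icc a b := by
    refine closure_minimal (fun x hx => ?_) isClosed_Icc
    by_contra hx'
    refine hx ?_
    rcases lt_or_ge x a with hxa | hxa
    · refine intervalIntegral.integral_zero_ae (Eventually.of_forall fun t ht => ?_)
      by_contra h
      have h1 := (hz t h).1
      rcases mem_uIoc.1 ht with h2 | h2 <;> linarith [(hs ha.1).1, h2.2]
    · have hbx : b < x := by
        by_contra h
        exact hx' ⟨hxa, not_lt.1 h⟩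
      show ∫ t in (0 : ℝ)..x, χ t = 0
      rw [intervalIntegral.integral_eq_integral_of_support_subset, h0]
      intro t ht
      exact ⟨(hs (subset_tsupport _ ht)).1, (hz t ht).2.trans hbx.le⟩
  exact ⟨_, hsm, HasCompactSupport.of_support_subset_isCompact isCompact_Icc
    ((subset_tsupport _).trans hsub),
    hsub.trans (Icc_subset_Ioo (hs ha.1).1 (hs hb.1).2), hde⟩

/-- Du Bois-Reymond: for a bump `η` of integral one, `φ - (∫ φ) η` has mean zero and hence is the
derivative of a test function, so `∫ w φ = (∫ φ) (∫ w η)`. The constant is `∫ w η`. -/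
theorem HasWeakDeriv.exists_ae_eq_const {ℓ : ℝ} (hℓ : 0 < ℓ) {w : ℝ → ℝ}
    (mw : MemLp w 2 (volume.restrict (Ioo (0 : ℝ) ℓ))) (hw : HasWeakDeriv ℓ w 0) :
    ∃ C : ℝ, w =ᵐ[volume.restrict (Ioo (0 : ℝ) ℓ)] fun _ => C := by
  let η : ContDiffBump (ℓ / 2) := ⟨ℓ / 8, ℓ / 4, by positivity, by linarith⟩
  have η1 : ContDiff ℝ ∞ (η.normed volume) := η.contDiff_normed
  have η2 : HasCompactSupport (η.normed volume) := η.hasCompactSupport_normed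
  have η3 : tsupport (η.normed volume) ⊆ Ioo (0 : ℝ) ℓ := by
    rw [η.tsupport_normed_eq, Real.closedBall_eq_Icc]
    exact Icc_subset_Ioo (by simp only [η]; linarith) (by simp only [η]; linarith)
  have hset : ∀ φ : ℝ → ℝ, tsupport φ ⊆ Ioo (0 : ℝ) ℓ →
      ∫ x in Ioo (0 : ℝ) ℓ, φ x = ∫ x, φ x := fun φ h =>
    setIntegral_eq_integral_of_forall_compl_eq_zero fun x hx =>
      image_eq_zero_of_notMem_tsupport fun hx' => hx (h hx')
  refine ⟨∫ x in Ioo (0 : ℝ) ℓ, w x * η.normed volume x,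
    ae_eq_of_forall_integral_test_eq mw (memLp_const _) fun φ h1 h2 h3 => ?_⟩
  set M := ∫ x, φ x with hM
  have h2' : HasCompactSupport fun x => M * η.normed volume x := η2.mul_left
  have hsub : tsupport (fun x => φ x - M * η.normed volume x) ⊆ Ioo (0 : ℝ) ℓ := by
    refine (tsupport_sub φ (fun x => M * η.normed volume x)).trans (union_subset h3 ?_)
    exact (tsupport_mul_subset_right).trans η3
  obtain ⟨ψ, p1, p2, p3, p4⟩ := exists_test_primitive (ℓ := ℓ)
    (h1.sub (contDiff_const.mul η1)) (h2.sub h2') hsub (by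
      have i2 : Integrable fun x => M * η.normed volume x :=
        (continuous_const.mul η1.continuous).integrable_of_hasCompactSupport h2'
      rw [integral_sub (h1.continuous.integrable_of_hasCompactSupport h2) i2,
        integral_const_mul, η.integral_normed, mul_one, sub_self])
  have h := hw ψ p1 p2 p3
  rw [p4] at h
  simp only [mul_sub, Pi.zero_apply, zero_mul, integral_zero, neg_zero, mul_left_comm _ M] at h
  rw [integral_sub (integrable_mul_test mw h1.continuous h2)
    ((integrable_mul_test mw η1.continuous η2).const_mul M), integral_const_mul] at h
  rw [integral_const_mul, hset φ h3, ← hM]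
  linarith

/-- Integration by parts for absolutely continuous functions; the test function kills the endpoint
terms. -/
theorem hasWeakDeriv_of_absolutelyContinuous {ℓ : ℝ} (hℓ : 0 < ℓ) {f g : ℝ → ℝ}
    (hf : AbsolutelyContinuousOnInterval f 0 ℓ)
    (hg : deriv f =ᵐ[volume.restrict (Ioo (0 : ℝ) ℓ)] g) : HasWeakDeriv ℓ f g := by
  intro φ h1 h2 h3
  have hφ : AbsolutelyContinuousOnInterval φ 0 ℓ :=
    ((h1.of_le (by simp)).contDiffOn).absolutelyContinuousOnInterval
  have h := hf.integral_mul_deriv_eq_deriv_mul hφ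
  have z0 : φ 0 = 0 := image_eq_zero_of_notMem_tsupport fun hx => lt_irrefl _ (h3 hx).1
  have zℓ : φ ℓ = 0 := image_eq_zero_of_notMem_tsupport fun hx => lt_irrefl _ (h3 hx).2
  rw [z0, zℓ, intervalIntegral.integral_of_le hℓ.le, intervalIntegral.integral_of_le hℓ.le,
    integral_Ioc_eq_integral_Ioo, integral_Ioc_eq_integral_Ioo] at h
  rw [h, mul_zero, mul_zero, sub_zero, zero_sub]
  refine congrArg _ (integral_congr_ae ?_)
  filter_upwards [hg] with x hx
  rw [hx]

/-- A function with a weak derivative has an absolutely continuous representative. -/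
theorem HasWeakDeriv.exists_absolutelyContinuous {ℓ : ℝ} (hℓ : 0 < ℓ) {u g : ℝ → ℝ}
    (mu : MemLp u 2 (volume.restrict (Ioo (0 : ℝ) ℓ)))
    (mg : MemLp g 2 (volume.restrict (Ioo (0 : ℝ) ℓ))) (h : HasWeakDeriv ℓ u g) :
    ∃ f : ℝ → ℝ, AbsolutelyContinuousOnInterval f 0 ℓ ∧
      deriv f =ᵐ[volume.restrict (Ioo (0 : ℝ) ℓ)] g ∧
      u =ᵐ[volume.restrict (Ioo (0 : ℝ) ℓ)] f := by
  have hi : IntervalIntegrable g volume 0 ℓ := by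
    rw [intervalIntegrable_iff_integrableOn_Ioo_of_le hℓ.le]
    exact mg.integrable (by norm_num)
  have hF := hi.absolutelyContinuousOnInterval_intervalIntegral (c := 0) (by simp)
  set F := fun x => ∫ v in (0 : ℝ)..x, g v with hFdef
  have hdF : ∀ᵐ x ∂volume.restrict (Ioo (0 : ℝ) ℓ), HasDerivAt F (g x) x := by
    rw [ae_restrict_iff' measurableSet_Ioo]
    filter_upwards [hi.ae_hasDerivAt_integral] with x hx hxm
    refine hx ?_ 0 (by simp)
    rw [uIcc_of_le hℓ.le]
    exact Ioo_subset_Icc_self hxm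
  have hdF' : deriv F =ᵐ[volume.restrict (Ioo (0 : ℝ) ℓ)] g := hdF.mono fun x hx => hx.deriv
  have hFc : ContinuousOn F (Icc 0 ℓ) := by simpa [uIcc_of_le hℓ.le] using hF.continuousOn
  have mF : MemLp F 2 (volume.restrict (Ioo (0 : ℝ) ℓ)) :=
    memLp_of_continuousOn_Icc hFc
  -- The difference of `u` and the primitive `F` of `g` has weak derivative zero, hence is constant.
  have hw : HasWeakDeriv ℓ (u + (-1 : ℝ) • F) (g + (-1 : ℝ) • g) :=
    HasWeakDeriv.add mu (mF.const_smul _) mg (mg.const_smul _) h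
      ((hasWeakDeriv_of_absolutelyContinuous hℓ hF hdF').smul _)
  have e0 : g + (-1 : ℝ) • g = 0 := by ext; simp
  rw [e0] at hw
  obtain ⟨C, hC⟩ := hw.exists_ae_eq_const hℓ (mu.add (mF.const_smul _))
  refine ⟨fun x => F x + C, hF.add (LipschitzOnWith.absolutelyContinuousOnInterval
    (K := 0) (LipschitzWith.const C).lipschitzOnWith), ?_, ?_⟩
  · filter_upwards [hdF] with x hx
    exact (hx.add_const C).deriv
  · filter_upwards [hC] with x hx
    simp only [Pi.add_apply, Pi.smul_apply, smul_eq_mul] at hx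
    linarith

/-- Makes endpoint values independent of the representative: continuous functions equal a.e. on the
interval agree up to its ends. -/
theorem IsContRep.eqOn {ℓ : ℝ} (hℓ : 0 < ℓ) {u f g : ℝ → ℝ} (hf : IsContRep ℓ u f)
    (hg : IsContRep ℓ u g) : EqOn f g (Icc 0 ℓ) := by
  refine Measure.eqOn_Icc_of_ae_eq volume hℓ.ne ?_ hf.1 hg.1
  rw [Measure.restrict_congr_set Ioo_ae_eq_Icc.symm]
  exact hf.2.symm.trans hg.2

theorem HasWeakDeriv.exists_isContRep {ℓ : ℝ} (hℓ : 0 < ℓ) {u g : ℝ → ℝ}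
    (mu : MemLp u 2 (volume.restrict (Ioo (0 : ℝ) ℓ)))
    (mg : MemLp g 2 (volume.restrict (Ioo (0 : ℝ) ℓ))) (h : HasWeakDeriv ℓ u g) :
    ∃ f, IsContRep ℓ u f := by
  obtain ⟨f, h1, -, h3⟩ := h.exists_absolutelyContinuous hℓ mu mg
  exact ⟨f, by simpa [uIcc_of_le hℓ.le] using h1.continuousOn, h3⟩

/-- Integration by parts in `H¹(0, ℓ)`. -/
theorem HasWeakDeriv.integral_add_eq {ℓ : ℝ} (hℓ : 0 < ℓ) {u v g h a b : ℝ → ℝ}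
    (mu : MemLp u 2 (volume.restrict (Ioo (0 : ℝ) ℓ)))
    (mv : MemLp v 2 (volume.restrict (Ioo (0 : ℝ) ℓ)))
    (mg : MemLp g 2 (volume.restrict (Ioo (0 : ℝ) ℓ)))
    (mh : MemLp h 2 (volume.restrict (Ioo (0 : ℝ) ℓ)))
    (hu : HasWeakDeriv ℓ u g) (hv : HasWeakDeriv ℓ v h)
    (ha : IsContRep ℓ u a) (hb : IsContRep ℓ v b) :
    (∫ x in Ioo (0 : ℝ) ℓ, g x * v x) + ∫ x in Ioo (0 : ℝ) ℓ, u x * h x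
      = a ℓ * b ℓ - a 0 * b 0 := by
  obtain ⟨f, f1, f2, f3⟩ := hu.exists_absolutelyContinuous hℓ mu mg
  obtain ⟨k, k1, k2, k3⟩ := hv.exists_absolutelyContinuous hℓ mv mh
  have ef := ha.eqOn hℓ ⟨by simpa [uIcc_of_le hℓ.le] using f1.continuousOn, f3⟩
  have ek := hb.eqOn hℓ ⟨by simpa [uIcc_of_le hℓ.le] using k1.continuousOn, k3⟩
  have i1 : Integrable (fun x => g x * v x) (volume.restrict (Ioo (0 : ℝ) ℓ)) :=
    mg.integrable_mul mv
  have i2 : Integrable (fun x => u x * h x) (volume.restrict (Ioo (0 : ℝ) ℓ)) :=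
    mu.integrable_mul mh
  have l0 : (0 : ℝ) ∈ Icc 0 ℓ := ⟨le_rfl, hℓ.le⟩
  have lℓ : ℓ ∈ Icc 0 ℓ := ⟨hℓ.le, le_rfl⟩
  rw [ef l0, ef lℓ, ek l0, ek lℓ, ← f1.integral_deriv_mul_eq_sub k1, ← integral_add i1 i2,
    intervalIntegral.integral_of_le hℓ.le, integral_Ioc_eq_integral_Ioo]
  refine integral_congr_ae ?_
  filter_upwards [f2, f3, k2, k3] with x h1 h2 h3 h4
  rw [h1, h2, h3, h4]

theorem ContDiff.hasWeakDeriv {ℓ : ℝ} (hℓ : 0 < ℓ) {f : ℝ → ℝ} (hf : ContDiff ℝ ∞ f) :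
    HasWeakDeriv ℓ f (deriv f) :=
  hasWeakDeriv_of_absolutelyContinuous hℓ
    ((hf.of_le (by simp)).contDiffOn).absolutelyContinuousOnInterval ae_eq_rfl

/-! ### Groups generated by skew-adjoint operators -/

section SkewAdjointGroups

open NormedSpace

variable {H : Type*} [NormedAddCommGroup H] [InnerProductSpace ℝ H]

theorem cauchySeq_of_dense {L : ℕ → H →L[ℝ] H} (hL : ∀ n x, ‖L n x‖ ≤ ‖x‖) {D : Set H}
    (hD : Dense D) (h : ∀ x ∈ D, CauchySeq fun n => L n x) (x : H) :
    CauchySeq fun n => L n x := by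
  rw [Metric.cauchySeq_iff]
  intro ε hε
  obtain ⟨y, hy, hxy⟩ := Metric.dense_iff.1 hD x (ε / 3) (by positivity)
  obtain ⟨M, hM⟩ := Metric.cauchySeq_iff.1 (h _ hxy) (ε / 3) (by positivity)
  refine ⟨M, fun m hm n hn => ?_⟩
  have hb : ∀ k, dist (L k x) (L k y) < ε / 3 := fun k => by
    rw [dist_eq_norm, ← map_sub]
    exact (hL k _).trans_lt (by rw [← dist_eq_norm, dist_comm]; exact hy)
  calc dist (L m x) (L n x)
      ≤ dist (L m x) (L m y) + dist (L m y) (L n y) + dist (L n y) (L n x) := dist_triangle4 _ _ _ _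
    _ < ε / 3 + ε / 3 + ε / 3 := by
        have := hb m
        have := hb n
        rw [dist_comm] at this
        have := hM m hm n hn
        linarith
    _ = ε := by ring

/-- Contractions are equicontinuous, so the set of points of convergence is closed. -/
theorem tendsto_of_dense {L : ℕ → H →L[ℝ] H} (hL : ∀ n x, ‖L n x‖ ≤ ‖x‖) {g : H → H}
    (hg : Continuous g) {D : Set H} (hD : Dense D)
    (h : ∀ x ∈ D, Tendsto (fun n => L n x) atTop (𝓝 (g x))) (x : H) :
    Tendsto (fun n => L n x) atTop (𝓝 (g x)) := by
  have he : Equicontinuous fun n => (L n : H → H) :=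
    (LipschitzWith.uniformEquicontinuous _ 1 fun n =>
      LipschitzWith.of_dist_le_mul fun a b => by
        rw [dist_eq_norm, ← map_sub, dist_eq_norm, NNReal.coe_one, one_mul]
        exact hL n _).equicontinuous
  have hc := he.isClosed_setOfPred_tendsto (l := atTop) hg
  exact closure_minimal (show D ⊆ {x | Tendsto (fun n => L n x) atTop (𝓝 (g x))} from h) hc (hD x)

/-! ### Exponentials of bounded skew operators -/

section Exponential

variable [CompleteSpace H] {K : H →L[ℝ] H}

theorem exp_add_of_commute_clm {K K' : H →L[ℝ] H} (h : Commute K K') :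
    exp (K + K') = exp K * exp K' := by
  let +nondep : NormedAlgebra ℚ (H →L[ℝ] H) := NormedAlgebra.restrictScalars ℚ ℝ _
  exact exp_add_of_commute h

/-- The exponential of a skew-adjoint bounded operator is unitary. -/
theorem norm_exp_smul_apply (hK : ∀ x y, ⟪K x, y⟫_ℝ = -⟪x, K y⟫_ℝ) (t : ℝ) (x : H) :
    ‖exp (t • K) x‖ = ‖x‖ := by
  have hs : t • K ∈ skewAdjoint (H →L[ℝ] H) := by
    rw [skewAdjoint.mem_iff, star_smul, star_trivial, ← smul_neg, ContinuousLinearMap.star_eq_adjoint]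
    congr 1
    refine ((ContinuousLinearMap.eq_adjoint_iff (-K) K).2 fun x y => ?_).symm
    rw [_root_.neg_apply, inner_neg_left, hK, neg_neg]
  let +nondep : NormedAlgebra ℚ (H →L[ℝ] H) := NormedAlgebra.restrictScalars ℚ ℝ _
  have hu := (Unitary.mem_iff.1 (exp_mem_unitary_of_mem_skewAdjoint hs)).1
  exact (ContinuousLinearMap.norm_map_iff_adjoint_comp_self _).2 hu x

theorem hasDerivAt_exp_smul_apply (K : H →L[ℝ] H) (x : H) (t : ℝ) :
    HasDerivAt (fun t : ℝ => exp (t • K) x) (exp (t • K) (K x)) t :=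
  (ContinuousLinearMap.apply ℝ H x).hasFDerivAt.comp_hasDerivAt t
    (hasDerivAt_exp_smul_const (𝕂 := ℝ) K t)

/-- Mean value inequality: the orbit has velocity `exp (t • K) (K x)`, of constant norm `‖K x‖`. -/
theorem norm_exp_smul_apply_sub_le (hK : ∀ x y, ⟪K x, y⟫_ℝ = -⟪x, K y⟫_ℝ) (t : ℝ) (x : H) :
    ‖exp (t • K) x - x‖ ≤ |t| * ‖K x‖ := by
  have h := convex_univ.norm_image_sub_le_of_norm_hasDerivWithin_le
    (f := fun t : ℝ => exp (t • K) x) (f' := fun t => exp (t • K) (K x)) (C := ‖K x‖)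
    (x := (0 : ℝ)) (y := t)
    (fun s _ => (hasDerivAt_exp_smul_apply K x s).hasDerivWithinAt)
    (fun s _ => (norm_exp_smul_apply hK s _).le) (mem_univ _) (mem_univ _)
  simpa [mul_comm] using h

/-- By commutation `exp (t • K) = exp (t • K') * exp (t • (K - K'))`. The first factor is isometric
and `K - K'` is again skew, which reduces the claim to the previous estimate. -/
theorem norm_exp_smul_apply_sub_exp_smul_apply_le {K' : H →L[ℝ] H}
    (hK : ∀ x y, ⟪K x, y⟫_ℝ = -⟪x, K y⟫_ℝ) (hK' : ∀ x y, ⟪K' x, y⟫_ℝ = -⟪x, K' y⟫_ℝ)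
    (hc : Commute K K') (t : ℝ) (x : H) :
    ‖exp (t • K) x - exp (t • K') x‖ ≤ |t| * ‖K x - K' x‖ := by
  have hc' : Commute (t • K') (t • (K - K')) :=
    ((hc.symm.sub_right (Commute.refl K')).smul_left t).smul_right t
  have e : exp (t • K) = exp (t • K') * exp (t • (K - K')) := by
    rw [← exp_add_of_commute_clm hc', ← smul_add, add_sub_cancel]
  have e' : exp (t • K) x - exp (t • K') x = exp (t • K') (exp (t • (K - K')) x - x) := by
    rw [e, map_sub]; rfl
  rw [e', norm_exp_smul_apply hK']
  refine norm_exp_smul_apply_sub_le (fun x y => ?_) t x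
  simp only [_root_.sub_apply, inner_sub_left, inner_sub_right, hK, hK']
  ring

end Exponential

/-- The graph of a skew-adjoint operator. -/
structure IsSkewAdjointGraph (G : Submodule ℝ (H × H)) : Prop where
  skew : ∀ x ∈ G, ∀ y ∈ G, ⟪x.2, y.1⟫_ℝ = -⟪x.1, y.2⟫_ℝ
  maximal : ∀ u f, (∀ y ∈ G, ⟪f, y.1⟫_ℝ = -⟪u, y.2⟫_ℝ) → (u, f) ∈ G
  dense : Dense {u | ∃ f, (u, f) ∈ G}

/-! ### Surjectivity and resolvents for skew-adjoint graphs -/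

namespace IsSkewAdjointGraph

variable {G : Submodule ℝ (H × H)}

theorem inner_self (hG : IsSkewAdjointGraph G) {u f : H} (h : (u, f) ∈ G) : ⟪f, u⟫_ℝ = 0 := by
  have := hG.skew _ h _ h
  rw [real_inner_comm f u] at this
  simp only at this
  linarith

theorem norm_sub_smul_sq (hG : IsSkewAdjointGraph G) {u f : H} (h : (u, f) ∈ G) (a : ℝ) :
    ‖u - a • f‖ ^ 2 = ‖u‖ ^ 2 + a ^ 2 * ‖f‖ ^ 2 := by
  rw [norm_sub_sq_real, real_inner_smul_right, real_inner_comm, hG.inner_self h, norm_smul,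
    mul_pow, Real.norm_eq_abs, sq_abs]
  ring

theorem norm_le (hG : IsSkewAdjointGraph G) {u f : H} (h : (u, f) ∈ G) (a : ℝ) :
    ‖u‖ ≤ ‖u - a • f‖ := by
  have := hG.norm_sub_smul_sq h a
  refine le_of_sq_le_sq ?_ (norm_nonneg _)
  nlinarith [mul_nonneg (sq_nonneg a) (sq_nonneg ‖f‖)]

/-- By skewness and maximality the graph is the set of pairs satisfying the skew relation with all
its elements, an intersection of closed sets. -/
theorem isClosed (hG : IsSkewAdjointGraph G) : IsClosed (G : Set (H × H)) := by
  have : (G : Set (H × H)) = ⋂ y ∈ G, {x : H × H | ⟪x.2, y.1⟫_ℝ = -⟪x.1, y.2⟫_ℝ} := by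
    ext x
    simp only [SetLike.mem_coe, mem_iInter]
    exact ⟨fun hx y hy => hG.skew x hx y hy, fun h => hG.maximal _ _ fun y hy => h y hy⟩
  rw [this]
  refine isClosed_biInter fun y _ => isClosed_eq ?_ ?_ <;> fun_prop

theorem exists_sub_smul_eq [CompleteSpace H] (hG : IsSkewAdjointGraph G) {a : ℝ} (ha : a ≠ 0)
    (f : H) : ∃ x ∈ G, x.1 - a • x.2 = f := by
  let Φ : H × H →L[ℝ] H := ContinuousLinearMap.fst ℝ H H - a • ContinuousLinearMap.snd ℝ H H
  let R : Submodule ℝ H := G.map (Φ : H × H →ₗ[ℝ] H)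
  have hcl : IsClosed (R : Set H) := by
    -- The Pythagorean identity bounds both components by `‖Φ x‖`, so `Φ` is bounded below on the
    -- complete space `G` and its range is closed.
    have hb : ∀ x ∈ G, ‖x‖ ≤ max 1 |a|⁻¹ * ‖Φ x‖ := by
      rintro ⟨u, w⟩ hx
      have h1 : ‖u‖ ≤ ‖Φ (u, w)‖ := hG.norm_le hx a
      have h2 : |a| * ‖w‖ ≤ ‖Φ (u, w)‖ := by
        have := hG.norm_sub_smul_sq hx a
        refine le_of_sq_le_sq ?_ (norm_nonneg _)
        show _ ≤ ‖u - a • w‖ ^ 2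
        rw [mul_pow, sq_abs, this]
        linarith [sq_nonneg ‖u‖]
      have hp : 0 < |a| := abs_pos.2 ha
      have h3 : ‖w‖ ≤ |a|⁻¹ * ‖Φ (u, w)‖ := by
        rw [inv_mul_eq_div, le_div_iff₀ hp, mul_comm]; exact h2
      refine max_le (h1.trans ?_) (h3.trans ?_)
      · exact le_mul_of_one_le_left (norm_nonneg _) (le_max_left _ _)
      · exact mul_le_mul_of_nonneg_right (le_max_right _ _) (norm_nonneg _)
    have hanti : AntilipschitzWith (max 1 |a|⁻¹).toNNReal (Φ.comp G.subtypeL) :=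
      ContinuousLinearMap.antilipschitz_of_bound _ fun x => by
        rw [Real.coe_toNNReal _ (le_max_of_le_left zero_le_one)]
        exact hb x x.2
    have : CompleteSpace G := hG.isClosed.completeSpace_coe
    have hr := hanti.isClosed_range (Φ.comp G.subtypeL).uniformContinuous
    convert hr using 1
    ext z
    simp [R]
  have horth : Rᗮ = ⊥ := by
    rw [Submodule.eq_bot_iff]
    intro v hv
    have hv' : ∀ y ∈ G, ⟪v, y.1⟫_ℝ = a * ⟪v, y.2⟫_ℝ := fun y hy => by
      have h := (Submodule.mem_orthogonal' R v).1 hv (Φ y) ⟨y, hy, rfl⟩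
      have h' : ⟪v, y.1 - a • y.2⟫_ℝ = 0 := h
      rw [inner_sub_right, real_inner_smul_right] at h'
      linarith
    -- Orthogonality to the range makes `v` an eigenvector for a nonzero real eigenvalue, which `⟪A
    -- v, v⟫ = 0` excludes unless `v = 0`.
    have hm : (v, -(a⁻¹ • v)) ∈ G := hG.maximal _ _ fun y hy => by
      rw [inner_neg_left, real_inner_smul_left, hv' y hy, inv_mul_cancel_left₀ ha]
    have := hG.inner_self hm
    rw [inner_neg_left, real_inner_smul_left, neg_eq_zero, mul_eq_zero] at this
    exact inner_self_eq_zero.1 (this.resolve_left (inv_ne_zero ha))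
  have : CompleteSpace R := hcl.completeSpace_coe
  have htop : R = ⊤ := (Submodule.orthogonal_eq_bot_iff).1 horth
  have hf : f ∈ R := htop ▸ Submodule.mem_top
  obtain ⟨x, hx, hxf⟩ := hf
  exact ⟨x, hx, hxf⟩

/-- The pair `(u, μ • (u - f))` in the graph encodes `A u = μ (u - f)`, that is `u = μ (μ - A)⁻¹ f`.
The difference of two solutions would be an eigenvector with real nonzero eigenvalue. -/
theorem unique (hG : IsSkewAdjointGraph G) {μ : ℝ} (hμ : μ ≠ 0) {f u v : H}
    (hu : (u, μ • (u - f)) ∈ G) (hv : (v, μ • (v - f)) ∈ G) : u = v := by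
  have h : (u - v, μ • (u - v)) ∈ G := by
    have := G.sub_mem hu hv
    rwa [Prod.mk_sub_mk, ← smul_sub, sub_sub_sub_cancel_right] at this
  have h0 := hG.inner_self h
  rw [real_inner_smul_left, mul_eq_zero] at h0
  exact sub_eq_zero.1 (inner_self_eq_zero.1 (h0.resolve_left hμ))

/-- The resolvents `R = μ (μ - A)⁻¹` of a skew-adjoint operator exist. -/
theorem exists_resolvent [CompleteSpace H] (hG : IsSkewAdjointGraph G) {μ : ℝ} (hμ : μ ≠ 0) :
    ∃ R : H →L[ℝ] H, (∀ f, ‖R f‖ ≤ ‖f‖) ∧ ∀ f, (R f, μ • (R f - f)) ∈ G := by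
  have hex : ∀ f, ∃ u, (u, μ • (u - f)) ∈ G := fun f => by
    obtain ⟨⟨u, w⟩, hx, rfl⟩ := hG.exists_sub_smul_eq (inv_ne_zero hμ) f
    refine ⟨u, ?_⟩
    simpa [smul_smul, hμ] using hx
  choose R hR using hex
  have hb : ∀ f, ‖R f‖ ≤ ‖f‖ := fun f => by
    have := hG.norm_le (hR f) μ⁻¹
    simpa [smul_smul, hμ] using this
  refine ⟨LinearMap.mkContinuous ⟨⟨R, fun f g => ?_⟩, fun a f => ?_⟩ 1
    (fun f => by simpa using hb f), hb, hR⟩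
  · refine hG.unique hμ (hR _) ?_
    have := G.add_mem (hR f) (hR g)
    rwa [Prod.mk_add_mk, ← smul_add, sub_add_sub_comm] at this
  · refine hG.unique hμ (hR _) ?_
    have := G.smul_mem a (hR f)
    rwa [Prod.smul_mk, smul_comm a μ, smul_sub] at this

/-! ### Adjoints, commutation and convergence of resolvents -/

section Resolvent

variable {μ ν : ℝ} {R S : H → H}

/-- The resolvents at `μ` and `-μ` are adjoint to each other because `A` is skew; this is what makes
their difference skew. -/
theorem inner_resolvent (hG : IsSkewAdjointGraph G) (hμ : μ ≠ 0)
    (hR : ∀ f, (R f, μ • (R f - f)) ∈ G) (hS : ∀ f, (S f, (-μ) • (S f - f)) ∈ G) (f g : H) :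
    ⟪R f, g⟫_ℝ = ⟪f, S g⟫_ℝ := by
  have h := hG.skew _ (hR f) _ (hS g)
  simp only [real_inner_smul_left, real_inner_smul_right, inner_sub_left, inner_sub_right] at h
  have : μ * (⟪R f, g⟫_ℝ - ⟪f, S g⟫_ℝ) = 0 := by linarith
  exact sub_eq_zero.1 ((mul_eq_zero.1 this).resolve_left hμ)

/-- The resolvent commutes with `A`: inverting the resolvent equation gives `R (u - μ⁻¹ A u) = u`,
from which `R A u = μ (R u - u) = A R u`. -/
theorem resolvent_mem {R : H →L[ℝ] H} (hG : IsSkewAdjointGraph G) (hμ : μ ≠ 0)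
    (hR : ∀ f, (R f, μ • (R f - f)) ∈ G) {u w : H} (h : (u, w) ∈ G) :
    (R u, R w) ∈ G ∧ R w = μ • (R u - u) := by
  have h1 : R (u - μ⁻¹ • w) = u := hG.unique hμ (hR _) (by simpa [smul_smul, hμ] using h)
  have h2 : R w = μ • (R u - u) := by
    conv_rhs => rw [← h1]
    rw [← map_sub, ← map_smul]
    congr 1
    rw [h1, sub_sub_cancel, smul_smul, mul_inv_cancel₀ hμ, one_smul]
  exact ⟨h2 ▸ hR u, h2⟩

/-- As `R` preserves the graph, `R (S f)` solves the equation that characterises `S (R f)`. -/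
theorem resolvent_commute {R S : H →L[ℝ] H} (hG : IsSkewAdjointGraph G) (hμ : μ ≠ 0) (hν : ν ≠ 0)
    (hR : ∀ f, (R f, μ • (R f - f)) ∈ G) (hS : ∀ f, (S f, ν • (S f - f)) ∈ G) :
    Commute R S := by
  ext f
  refine hG.unique hν (f := R f) ?_ (hS _)
  have := (hG.resolvent_mem hμ hR (hS f)).1
  rwa [map_smul, map_sub] at this

/-- On the domain `R n u = u + (μ n)⁻¹ R n (A u)`, and the last term tends to zero; contractivity
extends the limit from the dense domain. -/
theorem tendsto_resolvent {R : ℕ → H →L[ℝ] H} {μ : ℕ → ℝ} (hG : IsSkewAdjointGraph G)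
    (hμ : ∀ n, μ n ≠ 0) (hlim : Tendsto (fun n => (μ n)⁻¹) atTop (𝓝 0))
    (hb : ∀ n f, ‖R n f‖ ≤ ‖f‖)
    (hR : ∀ n f, (R n f, μ n • (R n f - f)) ∈ G) (x : H) :
    Tendsto (fun n => R n x) atTop (𝓝 x) := by
  refine tendsto_of_dense hb continuous_id hG.dense ?_ x
  rintro u ⟨w, hw⟩
  have e : ∀ n, R n u = u + (μ n)⁻¹ • R n w := fun n => by
    rw [(hG.resolvent_mem (hμ n) (hR n) hw).2, smul_smul, inv_mul_cancel₀ (hμ n), one_smul,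
      add_sub_cancel]
  simp only [e]
  have : Tendsto (fun n => (μ n)⁻¹ • R n w) atTop (𝓝 0) :=
    hlim.zero_smul_isBoundedUnder_le (isBoundedUnder_of ⟨‖w‖, fun n => hb n w⟩)
  simpa using this.const_add u

end Resolvent

/-- Skew-adjoint Yosida approximations of a skew-adjoint operator. -/
theorem exists_approximation [CompleteSpace H] (hG : IsSkewAdjointGraph G) :
    ∃ B : ℕ → H →L[ℝ] H, (∀ n x y, ⟪B n x, y⟫_ℝ = -⟪x, B n y⟫_ℝ) ∧
      (∀ m n, Commute (B m) (B n)) ∧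
      ∀ u w, (u, w) ∈ G → Tendsto (fun n => B n u) atTop (𝓝 w) := by
  have hp : ∀ n : ℕ, (n : ℝ) + 1 ≠ 0 := fun n => n.cast_add_one_ne_zero
  have hn : ∀ n : ℕ, -((n : ℝ) + 1) ≠ 0 := fun n => neg_ne_zero.2 (hp n)
  choose R hRb hR using fun n : ℕ => hG.exists_resolvent (hp n)
  choose S hSb hS using fun n : ℕ => hG.exists_resolvent (hn n)
  have hl : Tendsto (fun n : ℕ => ((n : ℝ) + 1)⁻¹) atTop (𝓝 0) := by
    simpa using tendsto_one_div_add_atTop_nhds_zero_nat (𝕜 := ℝ)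
  -- With `μ = n + 1`, `A R = μ (R - 1)` and `A S = -μ (S - 1)`, so this operator is `A (R + S) /
  -- 2`. Averaging the two resolvents makes the Yosida approximation skew.
  refine ⟨fun n => (((n : ℝ) + 1) / 2) • (R n - S n), fun n x y => ?_, fun m n => ?_,
    fun u w h => ?_⟩
  · have h1 := hG.inner_resolvent (hp n) (hR n) (hS n) x y
    have h2 := hG.inner_resolvent (hp n) (hR n) (hS n) y x
    rw [real_inner_comm x, real_inner_comm _ y] at h2
    simp only [_root_.smul_apply, _root_.sub_apply,
      real_inner_smul_left, real_inner_smul_right, inner_sub_left, inner_sub_right, h1, h2]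
    ring
  · refine Commute.smul_left (Commute.smul_right ?_ _) _
    exact ((hG.resolvent_commute (hp m) (hp n) (hR m) (hR n)).sub_right
      (hG.resolvent_commute (hp m) (hn n) (hR m) (hS n))).sub_left
      ((hG.resolvent_commute (hn m) (hp n) (hS m) (hR n)).sub_right
      (hG.resolvent_commute (hn m) (hn n) (hS m) (hS n)))
  · have e : ∀ n : ℕ, ((((n : ℝ) + 1) / 2) • (R n - S n)) u = (1 / 2 : ℝ) • (R n w + S n w) := by
      intro n
      rw [(hG.resolvent_mem (hp n) (hR n) h).2, (hG.resolvent_mem (hn n) (hS n) h).2]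
      simp only [_root_.smul_apply, _root_.sub_apply]
      module
    simp only [e]
    have h1 := hG.tendsto_resolvent hp hl hRb hR w
    have h2 := hG.tendsto_resolvent hn (by simpa only [inv_neg, neg_zero] using hl.neg) hSb hS w
    have h3 := (h1.add h2).const_smul (1 / 2 : ℝ)
    convert h3 using 2
    module

/-- A skew-adjoint operator generates a `C₀`-group of isometries. -/
theorem exists_group [CompleteSpace H] (hG : IsSkewAdjointGraph G) :
    ∃ T : ℝ → H →L[ℝ] H, IsC0Group T ∧ (∀ t, Isometry (T t)) ∧
      ∀ u f, (u, f) ∈ G ↔ Tendsto (fun h : ℝ => h⁻¹ • (T h u - u)) (𝓝[≠] 0) (𝓝 f) := by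
  obtain ⟨B, hB, hBc, hBt⟩ := hG.exists_approximation
  have hcau : ∀ t x, CauchySeq fun n => exp (t • B n) x := fun t => by
    refine cauchySeq_of_dense (fun n x => (norm_exp_smul_apply (hB n) t x).le) hG.dense ?_
    rintro u ⟨w, hw⟩
    have hc := (hBt u w hw).cauchySeq
    rw [Metric.cauchySeq_iff] at hc ⊢
    intro ε hε
    obtain ⟨M, hM⟩ := hc (ε / (|t| + 1)) (by positivity)
    refine ⟨M, fun m hm n hn => ?_⟩
    have h1 := norm_exp_smul_apply_sub_exp_smul_apply_le (hB m) (hB n) (hBc m n) t u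
    have h2 := hM m hm n hn
    rw [dist_eq_norm] at h2 ⊢
    rw [lt_div_iff₀ (by positivity)] at h2
    nlinarith [norm_nonneg (B m u - B n u)]
  choose L hL using fun t x => cauchySeq_tendsto_of_complete (hcau t x)
  let T : ℝ → H →L[ℝ] H := fun t =>
    continuousLinearMapOfTendsto (fun n => exp (t • B n)) (tendsto_pi_nhds.2 (hL t))
  have hT : ∀ t x, Tendsto (fun n => exp (t • B n) x) atTop (𝓝 (T t x)) := hL
  have hnorm : ∀ t x, ‖T t x‖ = ‖x‖ := fun t x =>
    tendsto_nhds_unique (hT t x).norm (by simp [norm_exp_smul_apply (hB _)])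
  have hlip : ∀ t u w, (u, w) ∈ G → ‖T t u - u‖ ≤ |t| * ‖w‖ := fun t u w h =>
    le_of_tendsto_of_tendsto' ((hT t u).sub_const u).norm ((hBt u w h).norm.const_mul |t|)
      fun n => norm_exp_smul_apply_sub_le (hB n) t u
  -- Limit in `m` of the comparison of two exponentials. The bound is linear in `t`, so it survives
  -- division by `t` in the difference quotient.
  have happ : ∀ n t u w, (u, w) ∈ G → ‖T t u - exp (t • B n) u‖ ≤ |t| * ‖w - B n u‖ :=
    fun n t u w h =>
    le_of_tendsto_of_tendsto' ((hT t u).sub_const _).norm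
      (((hBt u w h).sub_const _).norm.const_mul |t|) fun m =>
      norm_exp_smul_apply_sub_exp_smul_apply_le (hB m) (hB n) (hBc m n) t u
  have hzero : T 0 = ContinuousLinearMap.id ℝ H := by
    ext x
    refine tendsto_nhds_unique (hT 0 x) ?_
    simp
  have hadd : ∀ s t, T (s + t) = (T s).comp (T t) := fun s t => by
    ext x
    -- The operator and its argument both vary with `n`; the first summand tends to zero because the
    -- exponentials are isometric.
    have e : ∀ n, exp ((s + t) • B n) x
        = exp (s • B n) (exp (t • B n) x - T t x) + exp (s • B n) (T t x) := fun n => by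
      rw [← map_add, sub_add_cancel, add_smul,
        exp_add_of_commute_clm (((Commute.refl (B n)).smul_left s).smul_right t)]
      rfl
    refine tendsto_nhds_unique (hT (s + t) x) ?_
    simp only [e]
    have h0 : Tendsto (fun n => exp (s • B n) (exp (t • B n) x - T t x)) atTop (𝓝 0) := by
      rw [tendsto_zero_iff_norm_tendsto_zero]
      simp only [norm_exp_smul_apply (hB _)]
      exact tendsto_iff_norm_sub_tendsto_zero.1 (hT t x)
    simpa using h0.add (hT s (T t x))
  have hcont : ∀ u, Continuous fun t => T t u := by
    have hD : ∀ u w, (u, w) ∈ G → ∀ t, Tendsto (fun s => T s u) (𝓝 t) (𝓝 (T t u)) := by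
      intro u w h t
      rw [tendsto_iff_norm_sub_tendsto_zero]
      have e : ∀ s, ‖T s u - T t u‖ ≤ |s - t| * ‖w‖ := fun s => by
        have : T s u = T t (T (s - t) u) := by
          rw [← ContinuousLinearMap.comp_apply, ← hadd, add_sub_cancel]
        rw [this, ← map_sub, hnorm]
        exact hlip _ _ _ h
      refine squeeze_zero (fun _ => norm_nonneg _) e ?_
      have : Continuous fun s : ℝ => |s - t| * ‖w‖ := by fun_prop
      simpa using this.tendsto t
    intro u
    rw [Metric.continuous_iff]
    intro t ε hε
    obtain ⟨v, hv, w, hw⟩ := Metric.dense_iff.1 hG.dense u (ε / 3) (by positivity)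
    obtain ⟨δ, hδ, hd⟩ := Metric.tendsto_nhds_nhds.1 (hD v w hw t) (ε / 3) (by positivity)
    refine ⟨δ, hδ, fun s hs => ?_⟩
    have h1 := hd hs
    have hb : ∀ r, dist (T r u) (T r v) < ε / 3 := fun r => by
      rw [dist_eq_norm, ← map_sub, hnorm, ← dist_eq_norm, dist_comm]
      exact hv
    have h2 := hb s
    have h3 := hb t
    rw [dist_comm] at h3
    calc _ ≤ _ := dist_triangle4 (T s u) (T s v) (T t v) (T t u)
      _ < ε := by linarith
  have hgen : ∀ u w, (u, w) ∈ G →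
      Tendsto (fun h : ℝ => h⁻¹ • (T h u - u)) (𝓝[≠] 0) (𝓝 w) := by
    intro u w h
    rw [Metric.tendsto_nhds]
    intro ε hε
    -- A single `n` suffices for all `t`: the quotients of `T` and of `exp (t • B n)` differ by at
    -- most `‖w - B n u‖`.
    obtain ⟨n, hn⟩ := ((Metric.tendsto_nhds.1 (hBt u w h)) (ε / 3) (by positivity)).exists
    have hd := (hasDerivAt_exp_smul_apply (B n) u 0).tendsto_slope_zero
    have hd' := Metric.tendsto_nhds.1 hd (ε / 3) (by positivity)
    filter_upwards [hd', self_mem_nhdsWithin] with t ht ht0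
    simp only [zero_add, zero_smul, exp_zero, one_apply_eq_self] at ht
    have h1 : dist (t⁻¹ • (T t u - u)) (t⁻¹ • (exp (t • B n) u - u)) ≤ dist (B n u) w := by
      rw [dist_eq_norm, ← smul_sub, sub_sub_sub_cancel_right, norm_smul, norm_inv,
        Real.norm_eq_abs, inv_mul_le_iff₀ (abs_pos.2 ht0), dist_comm, dist_eq_norm]
      exact happ n t u w h
    calc _ ≤ _ := dist_triangle4 (t⁻¹ • (T t u - u)) (t⁻¹ • (exp (t • B n) u - u)) (B n u) w
      _ < ε := by linarith
  have hadj : ∀ t x y, ⟪T t x, y⟫_ℝ = ⟪x, T (-t) y⟫_ℝ := fun t x y => by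
    have e : y = T t (T (-t) y) := by
      rw [← ContinuousLinearMap.comp_apply, ← hadd, add_neg_cancel, hzero]; rfl
    conv_lhs => rw [e]
    exact (LinearMap.norm_map_iff_inner_map_map (T t)).1 (hnorm t) _ _
  refine ⟨T, ⟨hzero, hadd, hcont⟩, fun t => AddMonoidHomClass.isometry_of_norm _ (hnorm t),
    fun u f => ⟨hgen u f, fun hlim => hG.maximal u f ?_⟩⟩
  -- Since `T (-t)` is the adjoint of `T t`, pairing the quotient at `u` with `v` moves it onto `v`
  -- with time reversed. In the limit `⟪f, v⟫ = -⟪u, w⟫`, and maximality puts `(u, f)` in the graph.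
  rintro ⟨v, w⟩ hv
  have l1 := hlim.inner (𝕜 := ℝ) (tendsto_const_nhds (x := v))
  have hneg : Tendsto (fun h : ℝ => -h) (𝓝[≠] 0) (𝓝[≠] 0) := by
    refine tendsto_nhdsWithin_of_tendsto_nhds_of_eventually_within _ ?_ ?_
    · have : Tendsto (fun h : ℝ => -h) (𝓝 0) (𝓝 0) := by simpa using (continuous_neg (G := ℝ)).tendsto 0
      exact this.mono_left nhdsWithin_le_nhds
    · filter_upwards [self_mem_nhdsWithin] with t ht
      simpa using ht
  have l2 := (tendsto_const_nhds (x := u)).inner (𝕜 := ℝ) ((hgen v w hv).comp hneg)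
  refine tendsto_nhds_unique l1 (l2.neg.congr fun t => ?_)
  simp only [Function.comp_apply, real_inner_smul_left, real_inner_smul_right, inner_sub_left,
    inner_sub_right, hadj, inv_neg]
  ring

end IsSkewAdjointGraph

/-- Formal adjointness gives `skew`; `maximal` holds because its premise puts `(u, -f)` in the graph
of `A†`, which is that of `-A`. -/
theorem IsSkewAdjointOperator.isSkewAdjointGraph [CompleteSpace H] {A : H →ₗ.[ℝ] H}
    (hA : IsSkewAdjointOperator A) : IsSkewAdjointGraph A.graph := by
  obtain ⟨hd, hadj⟩ := hA
  refine ⟨?_, ?_, ?_⟩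
  · rintro ⟨u, f⟩ hu ⟨v, g⟩ hv
    obtain ⟨⟨u, hu'⟩, rfl, rfl⟩ := (LinearPMap.mem_graph_iff A).1 hu
    obtain ⟨⟨v, hv'⟩, rfl, rfl⟩ := (LinearPMap.mem_graph_iff A).1 hv
    have h := LinearPMap.adjoint_isFormalAdjoint hd
    rw [hadj] at h
    have := h ⟨u, hu'⟩ ⟨v, hv'⟩
    rw [LinearPMap.neg_apply, inner_neg_left] at this
    simp only at this ⊢
    rw [← this, neg_neg]
  · intro u f h
    have hu : ∀ x : A.domain, ⟪-f, (x : H)⟫_ℝ = ⟪u, A x⟫_ℝ := fun x => by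
      rw [inner_neg_left, h _ (A.mem_graph x), neg_neg]
    have hmem : u ∈ A†.domain := LinearPMap.mem_adjoint_domain_of_exists u ⟨-f, hu⟩
    have happ := LinearPMap.adjoint_apply_eq hd ⟨u, hmem⟩ hu
    have hg : (u, -f) ∈ A†.graph := happ ▸ A†.mem_graph ⟨u, hmem⟩
    rw [hadj] at hg
    obtain ⟨y, h1, h2⟩ := (LinearPMap.mem_graph_iff _).1 hg
    rw [LinearPMap.neg_apply, neg_inj] at h2
    exact (LinearPMap.mem_graph_iff _).2 ⟨y, h1, h2⟩
  · convert hd using 1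
    ext u
    simp only [Set.mem_ofPred_eq, SetLike.mem_coe, LinearPMap.mem_graph_iff]
    exact ⟨fun ⟨f, y, h, _⟩ => h ▸ y.2, fun h => ⟨_, ⟨u, h⟩, rfl, rfl⟩⟩

theorem IsSkewAdjointOperator.isMaximalDissipative [CompleteSpace H] {A : H →ₗ.[ℝ] H}
    (hA : IsSkewAdjointOperator A) : IsMaximalDissipative A := by
  have hG := hA.isSkewAdjointGraph
  refine ⟨fun u => (hG.inner_self (A.mem_graph u)).le, fun f => ?_⟩
  obtain ⟨x, hx, hxf⟩ := hG.exists_sub_smul_eq one_ne_zero f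
  obtain ⟨u, h1, h2⟩ := (LinearPMap.mem_graph_iff A).1 hx
  exact ⟨u, by rw [h1, h2, ← hxf, one_smul]⟩

theorem IsSkewAdjointOperator.exists_group [CompleteSpace H] {A : H →ₗ.[ℝ] H}
    (hA : IsSkewAdjointOperator A) :
    ∃ T : ℝ → H →L[ℝ] H, IsC0Group T ∧ (∀ t, Isometry (T t)) ∧ IsGenerator A T :=
  hA.isSkewAdjointGraph.exists_group

/-- A densely defined operator is skew-adjoint if it is skew-symmetric and the domain of the
adjoint is contained in the domain. -/
theorem isSkewAdjointOperator_of_le [CompleteSpace H] {A : H →ₗ.[ℝ] H}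
    (hd : Dense (A.domain : Set H)) (hs : ∀ u v : A.domain, ⟪A u, (v : H)⟫_ℝ = -⟪(u : H), A v⟫_ℝ)
    (hm : ∀ v w : H, (∀ u : A.domain, ⟪A u, v⟫_ℝ = ⟪(u : H), w⟫_ℝ) → v ∈ A.domain) :
    IsSkewAdjointOperator A := by
  have hf : A.IsFormalAdjoint (-A) := fun u v => by
    rw [LinearPMap.neg_apply, inner_neg_right]
    exact hs u v
  refine ⟨hd, (LinearPMap.eq_of_le_of_domain_eq (hf.le_adjoint hd) ?_).symm⟩
  refine le_antisymm (hf.le_adjoint hd).1 fun v hv => ?_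
  refine hm v (A† ⟨v, hv⟩) fun u => ?_
  rw [real_inner_comm, ← LinearPMap.adjoint_isFormalAdjoint hd ⟨v, hv⟩ u, real_inner_comm]

end SkewAdjointGroups

/-! ### Weighted `L²` spaces -/

theorem WeightedL2.inner_eq {ℓ w : ℝ} (hw : 0 < w) (u v : WeightedL2 ℓ w) :
    ⟪u, v⟫_ℝ = w * ∫ x in Ioo (0 : ℝ) ℓ, u x * v x := by
  rw [L2.inner_def, integral_smul_measure, ENNReal.toReal_ofReal hw.le, smul_eq_mul]
  congr 1
  refine integral_congr_ae (Eventually.of_forall fun x => ?_)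
  simp [mul_comm]

/-- The class in the weighted `L²(0, ℓ)` of a function in `L²(0, ℓ)`. -/
noncomputable def WeightedL2.mk {ℓ : ℝ} (w : ℝ) {f : ℝ → ℝ}
    (hf : MemLp f 2 (volume.restrict (Ioo (0 : ℝ) ℓ))) : WeightedL2 ℓ w :=
  (hf.smul_measure (c := ENNReal.ofReal w) ENNReal.ofReal_ne_top).toLp f

theorem WeightedL2.coeFn_mk {ℓ w : ℝ} (hw : 0 < w) {f : ℝ → ℝ}
    (hf : MemLp f 2 (volume.restrict (Ioo (0 : ℝ) ℓ))) :
    (WeightedL2.mk w hf : ℝ → ℝ) =ᵐ[volume.restrict (Ioo (0 : ℝ) ℓ)] f :=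
  ae_of_ae_weighted hw (MemLp.coeFn_toLp _)

theorem WeightedL2.ext {ℓ w : ℝ} {u v : WeightedL2 ℓ w}
    (h : (u : ℝ → ℝ) =ᵐ[volume.restrict (Ioo (0 : ℝ) ℓ)] v) : u = v :=
  Lp.ext (Measure.ae_smul_measure h _)

theorem HasWeakDeriv.congr_right {ℓ : ℝ} {u g h : ℝ → ℝ} (hu : HasWeakDeriv ℓ u g)
    (hgh : h =ᵐ[volume.restrict (Ioo (0 : ℝ) ℓ)] g) : HasWeakDeriv ℓ u h := by
  intro φ h1 h2 h3
  rw [hu φ h1 h2 h3]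
  refine congrArg _ (integral_congr_ae ?_)
  filter_upwards [hgh] with x hx
  rw [hx]

theorem hasWeakDeriv_weakDeriv {ℓ w w' : ℝ} (hw : 0 < w) (hw' : 0 < w') (u : SobolevH1 ℓ hw) :
    HasWeakDeriv ℓ (u : WeightedL2 ℓ w) (weakDeriv ℓ hw w' u) :=
  u.2.choose_spec.2.congr_right (ae_of_ae_weighted hw' (MemLp.coeFn_toLp
    (u.2.choose_spec.1.smul_measure (c := ENNReal.ofReal w') ENNReal.ofReal_ne_top)))

theorem memLp_deriv {h : ℝ → ℝ} (hh : ContDiff ℝ ∞ h) (ℓ : ℝ) :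
    MemLp (deriv h) 2 (volume.restrict (Ioo (0 : ℝ) ℓ)) :=
  memLp_of_continuousOn_Icc (hh.continuous_deriv (by simp)).continuousOn

namespace PipeNetwork

variable {V E : Type*} (N : PipeNetwork V E)

/-! ### Nodes -/

theorem xi_source (k : E) : N.xi k (N.source k) = -1 := by simp [xi]

theorem xi_target (k : E) : N.xi k (N.target k) = 1 := by
  simp [xi, (N.source_ne_target k).symm]

theorem eq_source_or_eq_target {k : E} {v : V} (h : N.xi k v ≠ 0) :
    v = N.source k ∨ v = N.target k := by
  unfold xi at h
  split_ifs at h with h1 h2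
  · exact Or.inl h1
  · exact Or.inr h2
  · exact absurd rfl h

theorem xi_mul_self {k : E} {v : V} (h : N.xi k v ≠ 0) : N.xi k v * N.xi k v = 1 := by
  rcases N.eq_source_or_eq_target h with rfl | rfl
  · rw [xi_source]; norm_num
  · rw [xi_target]; norm_num

@[simp]
theorem nodeValue_source (f : ℝ → ℝ) (k : E) : N.nodeValue f k (N.source k) = f 0 := by
  simp [nodeValue]

@[simp]
theorem nodeValue_target (f : ℝ → ℝ) (k : E) : N.nodeValue f k (N.target k) = f (N.length k) := by
  simp [nodeValue, (N.source_ne_target k).symm]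

theorem sum_xi_mul [Fintype V] (k : E) (a : V → ℝ) :
    ∑ v, N.xi k v * a v = a (N.target k) - a (N.source k) := by
  classical
  rw [Finset.sum_eq_add_of_mem (N.source k) (N.target k) (Finset.mem_univ _) (Finset.mem_univ _)
    (N.source_ne_target k), xi_source, xi_target]
  · ring
  · rintro v - ⟨h1, h2⟩
    simp [xi, h1, h2]

theorem isEntry_source {k : E} (h : ¬ N.IsInterior (N.source k)) : N.IsEntry (N.source k) :=
  ⟨h, k, N.xi_source k⟩

theorem isExit_target {k : E} (h : ¬ N.IsInterior (N.target k)) : N.IsExit (N.target k) :=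
  ⟨h, k, N.xi_target k⟩

/-- The affine function on the pipe `k` with prescribed values at the two end nodes. -/
noncomputable def affine (a : V → ℝ) (k : E) (x : ℝ) : ℝ :=
  a (N.source k) + x / N.length k * (a (N.target k) - a (N.source k))

@[simp]
theorem affine_zero (a : V → ℝ) (k : E) : N.affine a k 0 = a (N.source k) := by simp [affine]

@[simp]
theorem affine_length (a : V → ℝ) (k : E) : N.affine a k (N.length k) = a (N.target k) := by
  simp [affine, (N.length_pos k).ne']

theorem contDiff_affine (a : V → ℝ) (k : E) : ContDiff ℝ ∞ (N.affine a k) := by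
  unfold affine
  fun_prop

theorem nodeValue_affine (a : V → ℝ) {k : E} {v : V} (h : N.xi k v ≠ 0) :
    N.nodeValue (N.affine a k) k v = a v := by
  rcases N.eq_source_or_eq_target h with rfl | rfl <;> simp

/-- The state with smooth pressures `f k` and fluxes `g k`. -/
noncomputable def ofSmooth (f g : E → ℝ → ℝ) (hf : ∀ k, ContDiff ℝ ∞ (f k)) (hg : ∀ k, ContDiff ℝ ∞ (g k)) :
    N.StateSpace :=
  WithLp.toLp 2 fun k => WithLp.toLp 2
    (WeightedL2.mk (N.pWeight k) (memLp_of_continuousOn_Icc (hf k).continuous.continuousOn),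
      WeightedL2.mk (N.qWeight k) (memLp_of_continuousOn_Icc (hg k).continuous.continuousOn))

section

variable {f g : E → ℝ → ℝ} (hf : ∀ k, ContDiff ℝ ∞ (f k)) (hg : ∀ k, ContDiff ℝ ∞ (g k))

theorem pressure_ofSmooth (k : E) :
    pressure (N.ofSmooth f g hf hg) k =ᵐ[volume.restrict (Ioo 0 (N.length k))] f k :=
  WeightedL2.coeFn_mk (N.pWeight_pos k) (memLp_of_continuousOn_Icc (hf k).continuous.continuousOn)

theorem flux_ofSmooth (k : E) :
    flux (N.ofSmooth f g hf hg) k =ᵐ[volume.restrict (Ioo 0 (N.length k))] g k :=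
  WeightedL2.coeFn_mk (N.qWeight_pos k) (memLp_of_continuousOn_Icc (hg k).continuous.continuousOn)

theorem isContRep_pressure_ofSmooth (k : E) :
    IsContRep (N.length k) (pressure (N.ofSmooth f g hf hg) k) (f k) :=
  ⟨(hf k).continuous.continuousOn, N.pressure_ofSmooth hf hg k⟩

theorem isContRep_flux_ofSmooth (k : E) :
    IsContRep (N.length k) (flux (N.ofSmooth f g hf hg) k) (g k) :=
  ⟨(hg k).continuous.continuousOn, N.flux_ofSmooth hf hg k⟩

theorem hasWeakDeriv_pressure_ofSmooth (k : E) :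
    HasWeakDeriv (N.length k) (pressure (N.ofSmooth f g hf hg) k) (deriv (f k)) :=
  (ContDiff.hasWeakDeriv (N.length_pos k) (hf k)).congr (N.pressure_ofSmooth hf hg k)

theorem hasWeakDeriv_flux_ofSmooth (k : E) :
    HasWeakDeriv (N.length k) (flux (N.ofSmooth f g hf hg) k) (deriv (g k)) :=
  (ContDiff.hasWeakDeriv (N.length_pos k) (hg k)).congr (N.flux_ofSmooth hf hg k)

end

variable [Fintype E]

theorem isInterior_of_ne {v : V} {j k : E} (hj : N.xi j v ≠ 0) (hk : N.xi k v ≠ 0) (h : j ≠ k) :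
    N.IsInterior v :=
  (Set.one_lt_ncard (Set.toFinite _)).2 ⟨j, hj, k, hk, h⟩

theorem IsInterior.exists_xi_ne_zero {v : V} (h : N.IsInterior v) : ∃ k, N.xi k v ≠ 0 := by
  obtain ⟨j, hj, -⟩ := (Set.one_lt_ncard (Set.toFinite _)).1 h
  exact ⟨j, hj⟩

variable {N} in
-- At an interior node the common pressure factors out and Kirchhoff's law for the other state
-- applies. At a boundary node the one product vanishes through its pressure (entry) or its flux
-- (exit).
theorem NodeConditions.sum_eq_zero {p q p' q' : E → ℝ → ℝ} (h : N.NodeConditions p q)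
    (h' : N.NodeConditions p' q') (v : V) :
    ∑ k, N.xi k v * (N.diam k ^ 2 * (N.nodeValue (p k) k v * N.nodeValue (q' k) k v)) = 0 := by
  by_cases hv : N.IsInterior v
  · obtain ⟨j, hj⟩ := IsInterior.exists_xi_ne_zero N hv
    have e : ∀ k, N.xi k v * (N.diam k ^ 2 * (N.nodeValue (p k) k v * N.nodeValue (q' k) k v))
        = N.nodeValue (p j) j v * (N.xi k v * N.diam k ^ 2 * N.nodeValue (q' k) k v) := fun k => by
      by_cases hk : N.xi k v = 0
      · simp [hk]
      · rw [h.continuity v hv k j hk hj]; ring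
    simp only [e]
    rw [← Finset.mul_sum, h'.kirchhoff v hv, mul_zero]
  · refine Finset.sum_eq_zero fun k _ => ?_
    by_cases hk : N.xi k v = 0
    · simp [hk]
    · rcases N.eq_source_or_eq_target hk with rfl | rfl
      · simp [h.entry k (N.isEntry_source hv)]
      · simp [h'.exit k (N.isExit_target hv)]

theorem nodeConditions_of_eq_zero {p q : E → ℝ → ℝ} (h1 : ∀ k, p k 0 = 0)
    (h2 : ∀ k, p k (N.length k) = 0) (h3 : ∀ k, q k 0 = 0) (h4 : ∀ k, q k (N.length k) = 0) :
    N.NodeConditions p q := by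
  have hz : ∀ f : E → ℝ → ℝ, (∀ k, f k 0 = 0) → (∀ k, f k (N.length k) = 0) →
      ∀ k v, N.nodeValue (f k) k v = 0 := fun f hf0 hfl k v => by
    unfold nodeValue
    split_ifs
    exacts [hf0 k, hfl k]
  refine ⟨fun k _ => h1 k, fun k _ => h4 k, fun v _ j k _ _ => ?_, fun v _ => ?_⟩
  · rw [hz p h1 h2, hz p h1 h2]
  · simp [hz q h3 h4]

/-- The nodal data may depend on the pipe, since fluxes at a node differ from pipe to pipe. -/
theorem nodeConditions_affine {a b : E → V → ℝ}
    (h1 : ∀ k, N.IsEntry (N.source k) → a k (N.source k) = 0)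
    (h2 : ∀ k, N.IsExit (N.target k) → b k (N.target k) = 0)
    (h3 : ∀ v, N.IsInterior v → ∀ j k, N.xi j v ≠ 0 → N.xi k v ≠ 0 → a j v = a k v)
    (h4 : ∀ v, N.IsInterior v → ∑ k, N.xi k v * N.diam k ^ 2 * b k v = 0) :
    N.NodeConditions (fun k => N.affine (a k) k) (fun k => N.affine (b k) k) := by
  refine ⟨fun k hk => by simp [h1 k hk], fun k hk => by simp [h2 k hk],
    fun v hv j k hj hk => ?_, fun v hv => ?_⟩
  · rw [N.nodeValue_affine _ hj, N.nodeValue_affine _ hk, h3 v hv j k hj hk]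
  · rw [← h4 v hv]
    refine Finset.sum_congr rfl fun k _ => ?_
    by_cases hk : N.xi k v = 0
    · simp [hk]
    · rw [N.nodeValue_affine _ hk]

/-! ### The state space -/

theorem inner_eq (u v : N.StateSpace) :
    ⟪u, v⟫_ℝ = ∑ k, (N.pWeight k * (∫ x in Ioo 0 (N.length k), pressure u k x * pressure v k x)
      + N.qWeight k * ∫ x in Ioo 0 (N.length k), flux u k x * flux v k x) := by
  rw [PiLp.inner_apply]
  refine Finset.sum_congr rfl fun k _ => ?_
  rw [WithLp.prod_inner_apply, WeightedL2.inner_eq (N.pWeight_pos k),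
    WeightedL2.inner_eq (N.qWeight_pos k)]
  rfl

section

variable {f g : E → ℝ → ℝ} (hf : ∀ k, ContDiff ℝ ∞ (f k)) (hg : ∀ k, ContDiff ℝ ∞ (g k))

theorem inner_ofSmooth (v : N.StateSpace) :
    ⟪N.ofSmooth f g hf hg, v⟫_ℝ =
      ∑ k, (N.pWeight k * (∫ x in Ioo 0 (N.length k), f k x * pressure v k x)
        + N.qWeight k * ∫ x in Ioo 0 (N.length k), g k x * flux v k x) := by
  rw [inner_eq]
  refine Finset.sum_congr rfl fun k _ => ?_
  congr 2
  · refine integral_congr_ae ?_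
    filter_upwards [N.pressure_ofSmooth hf hg k] with x hx
    rw [hx]
  · refine integral_congr_ae ?_
    filter_upwards [N.flux_ofSmooth hf hg k] with x hx
    rw [hx]

theorem ofSmooth_mem_waveDomain (h : N.NodeConditions f g) :
    N.ofSmooth f g hf hg ∈ N.waveDomain :=
  ⟨fun k => ⟨_, memLp_deriv (hf k) _, N.hasWeakDeriv_pressure_ofSmooth hf hg k⟩,
    fun k => ⟨_, memLp_deriv (hg k) _, N.hasWeakDeriv_flux_ofSmooth hf hg k⟩, f, g,
    N.isContRep_pressure_ofSmooth hf hg, N.isContRep_flux_ofSmooth hf hg, h⟩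

end

omit [Fintype E] in
theorem contDiff_single [DecidableEq E] {φ : ℝ → ℝ} (hφ : ContDiff ℝ ∞ φ) (k j : E) :
    ContDiff ℝ ∞ ((Pi.single k φ : E → ℝ → ℝ) j) := by
  by_cases h : j = k
  · subst h; simpa using hφ
  · rw [Pi.single_eq_of_ne h]
    exact contDiff_const

omit [Fintype E] in
theorem single_apply_endpoints [DecidableEq E] {φ : ℝ → ℝ} {k : E}
    (h : tsupport φ ⊆ Ioo 0 (N.length k)) (j : E) :
    (Pi.single k φ : E → ℝ → ℝ) j 0 = 0 ∧ (Pi.single k φ : E → ℝ → ℝ) j (N.length j) = 0 := by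
  by_cases hj : j = k
  · subst hj
    simp only [Pi.single_eq_same]
    exact ⟨image_eq_zero_of_notMem_tsupport fun hx => lt_irrefl _ (h hx).1,
      image_eq_zero_of_notMem_tsupport fun hx => lt_irrefl _ (h hx).2⟩
  · simp [hj]

/-- A test function placed in one component of one pipe vanishes at all ends and so lies in the
domain; a state orthogonal to all of these is zero. -/
theorem dense_waveDomain : Dense (N.waveDomain : Set N.StateSpace) := by
  classical
  rw [Submodule.dense_iff_topologicalClosure_eq_top, Submodule.topologicalClosure_eq_top_iff,
    Submodule.eq_bot_iff]
  intro v hv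
  have h0 : ContDiff ℝ ∞ (0 : ℝ → ℝ) := contDiff_const
  have hp : ∀ k, pressure v k = 0 := fun k => by
    refine WeightedL2.ext (EventuallyEq.trans ?_ (WeightedL2.coeFn_zero (N.pWeight_pos k)).symm)
    refine ae_eq_of_forall_integral_test_eq (WeightedL2.memLp (N.pWeight_pos k) _) MemLp.zero
      fun φ h1 h2 h3 => ?_
    have h := (Submodule.mem_orthogonal _ v).1 hv _ (N.ofSmooth_mem_waveDomain (contDiff_single h1 k)
      (fun _ => h0) (N.nodeConditions_of_eq_zero (fun j => (N.single_apply_endpoints h3 j).1)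
        (fun j => (N.single_apply_endpoints h3 j).2) (fun _ => rfl) (fun _ => rfl)))
    rw [inner_ofSmooth, Finset.sum_eq_single k (fun j _ hj => by simp [hj]) (by simp)] at h
    simp only [Pi.single_eq_same, Pi.zero_apply, zero_mul, integral_zero, mul_zero, add_zero,
      mul_eq_zero, (N.pWeight_pos k).ne', false_or] at h
    simpa [mul_comm] using h
  have hq : ∀ k, flux v k = 0 := fun k => by
    refine WeightedL2.ext (EventuallyEq.trans ?_ (WeightedL2.coeFn_zero (N.qWeight_pos k)).symm)
    refine ae_eq_of_forall_integral_test_eq (WeightedL2.memLp (N.qWeight_pos k) _) MemLp.zero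
      fun φ h1 h2 h3 => ?_
    have h := (Submodule.mem_orthogonal _ v).1 hv _ (N.ofSmooth_mem_waveDomain (fun _ => h0)
      (contDiff_single h1 k) (N.nodeConditions_of_eq_zero (fun _ => rfl) (fun _ => rfl)
        (fun j => (N.single_apply_endpoints h3 j).1) (fun j => (N.single_apply_endpoints h3 j).2)))
    rw [inner_ofSmooth, Finset.sum_eq_single k (fun j _ hj => by simp [hj]) (by simp)] at h
    simp only [Pi.single_eq_same, Pi.zero_apply, zero_mul, integral_zero, mul_zero, zero_add,
      mul_eq_zero, (N.qWeight_pos k).ne', false_or] at h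
    simpa [mul_comm] using h
  ext1 k
  exact WithLp.ofLp_injective 2 (Prod.ext (hp k) (hq k))

/-! ### The wave operator -/

/-- The weak form of `u' = A u`, without node conditions. -/
structure IsWeakImage (u u' : N.StateSpace) : Prop where
  pressure : ∀ k, HasWeakDeriv (N.length k) (pressure u k) (fun x => -flux u' k x)
  flux : ∀ k, HasWeakDeriv (N.length k) (flux u k)
    (fun x => -((N.c ^ 2)⁻¹ * PipeNetwork.pressure u' k x))

theorem isWeakImage_waveOperator (u : N.waveOperator.domain) :
    N.IsWeakImage u (N.waveOperator u) := by
  refine ⟨fun k => ?_, fun k => ?_⟩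
  · refine (hasWeakDeriv_weakDeriv (N.pWeight_pos k) (N.qWeight_pos k)
      ⟨PipeNetwork.pressure u.1 k, u.2.1 k⟩).congr_right ?_
    filter_upwards [ae_of_ae_weighted (N.qWeight_pos k) (Lp.coeFn_neg (weakDeriv (N.length k)
      (N.pWeight_pos k) (N.qWeight k) ⟨PipeNetwork.pressure u.1 k, u.2.1 k⟩))] with x hx
    rw [neg_eq_iff_eq_neg]
    exact hx
  · refine (hasWeakDeriv_weakDeriv (N.qWeight_pos k) (N.pWeight_pos k)
      ⟨PipeNetwork.flux u.1 k, u.2.2.1 k⟩).congr_right ?_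
    filter_upwards [ae_of_ae_weighted (N.pWeight_pos k) (Lp.coeFn_neg (N.c ^ 2 • weakDeriv
      (N.length k) (N.qWeight_pos k) (N.pWeight k) ⟨PipeNetwork.flux u.1 k, u.2.2.1 k⟩)),
      WeightedL2.coeFn_smul (N.pWeight_pos k) (N.c ^ 2) (weakDeriv
      (N.length k) (N.qWeight_pos k) (N.pWeight k) ⟨PipeNetwork.flux u.1 k, u.2.2.1 k⟩)] with x hx hy
    have h : PipeNetwork.pressure (N.waveOperator u) k x = _ := hx
    rw [h, Pi.neg_apply, hy, Pi.smul_apply, smul_eq_mul, mul_neg, neg_neg,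
      inv_mul_cancel_left₀ (pow_pos N.c_pos 2).ne']

omit [Fintype E] in
variable {N} in
theorem IsWeakImage.mem_sobolevH1 {u u' : N.StateSpace} (h : N.IsWeakImage u u') (k : E) :
    PipeNetwork.pressure u k ∈ SobolevH1 (N.length k) (N.pWeight_pos k) ∧
      PipeNetwork.flux u k ∈ SobolevH1 (N.length k) (N.qWeight_pos k) :=
  ⟨⟨_, (WeightedL2.memLp (N.qWeight_pos k) _).neg, h.pressure k⟩,
    ⟨_, ((WeightedL2.memLp (N.pWeight_pos k) _).const_mul _).neg, h.flux k⟩⟩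

variable {N} in
/-- Green's formula on the network. -/
theorem IsWeakImage.inner_add_inner {u u' v v' : N.StateSpace} (hu : N.IsWeakImage u u')
    (hv : N.IsWeakImage v v') {p q p' q' : E → ℝ → ℝ}
    (hp : ∀ k, IsContRep (N.length k) (PipeNetwork.pressure u k) (p k))
    (hq : ∀ k, IsContRep (N.length k) (PipeNetwork.flux u k) (q k))
    (hp' : ∀ k, IsContRep (N.length k) (PipeNetwork.pressure v k) (p' k))
    (hq' : ∀ k, IsContRep (N.length k) (PipeNetwork.flux v k) (q' k)) :
    ⟪u', v⟫_ℝ + ⟪u, v'⟫_ℝ = -(N.c ^ 2 * ∑ k, N.diam k ^ 2 *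
      ((p k (N.length k) * q' k (N.length k) - p k 0 * q' k 0)
        + (p' k (N.length k) * q k (N.length k) - p' k 0 * q k 0))) := by
  rw [inner_eq, inner_eq, ← Finset.sum_add_distrib, Finset.mul_sum, ← Finset.sum_neg_distrib]
  refine Finset.sum_congr rfl fun k _ => ?_
  have mp : ∀ z : N.StateSpace, MemLp (PipeNetwork.pressure z k) 2 _ :=
    fun z => WeightedL2.memLp (N.pWeight_pos k) _
  have mq : ∀ z : N.StateSpace, MemLp (PipeNetwork.flux z k) 2 _ :=
    fun z => WeightedL2.memLp (N.qWeight_pos k) _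
  rw [mul_comm (p' k _) (q k _), mul_comm (p' k 0) (q k 0),
    ← HasWeakDeriv.integral_add_eq (N.length_pos k) (mp u) (mq v) (mq u').neg
    ((mp v').const_mul _).neg (hu.pressure k) (hv.flux k) (hp k) (hq' k),
    ← HasWeakDeriv.integral_add_eq (N.length_pos k) (mq u) (mp v) ((mp u').const_mul _).neg
    (mq v').neg (hu.flux k) (hv.pressure k) (hq k) (hp' k)]
  simp only [Pi.neg_apply, neg_mul, mul_neg, mul_assoc, mul_left_comm _ (N.c ^ 2)⁻¹, integral_neg,
    integral_const_mul, pWeight, qWeight]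
  have := N.c_pos.ne'
  field_simp
  ring

/-- Regroups the endpoint terms of the pipes by nodes; `xi` supplies the sign of each end. -/
theorem sum_boundary [Fintype V] (p q : E → ℝ → ℝ) :
    ∑ k, N.diam k ^ 2 * (p k (N.length k) * q k (N.length k) - p k 0 * q k 0)
      = ∑ v, ∑ k, N.xi k v *
          (N.diam k ^ 2 * (N.nodeValue (p k) k v * N.nodeValue (q k) k v)) := by
  rw [Finset.sum_comm]
  refine Finset.sum_congr rfl fun k _ => ?_
  rw [N.sum_xi_mul k fun v => N.diam k ^ 2 * (N.nodeValue (p k) k v * N.nodeValue (q k) k v)]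
  simp only [nodeValue_source, nodeValue_target]
  ring

theorem waveOperator_skew [Finite V] (u v : N.waveOperator.domain) :
    ⟪N.waveOperator u, (v : N.StateSpace)⟫_ℝ = -⟪(u : N.StateSpace), N.waveOperator v⟫_ℝ := by
  cases nonempty_fintype V
  obtain ⟨p, q, hp, hq, h⟩ := u.2.2.2
  obtain ⟨p', q', hp', hq', h'⟩ := v.2.2.2
  rw [← sub_eq_zero, sub_neg_eq_add, (N.isWeakImage_waveOperator u).inner_add_inner
    (N.isWeakImage_waveOperator v) hp hq hp' hq']
  simp only [mul_add, Finset.sum_add_distrib, sum_boundary, h.sum_eq_zero h', h'.sum_eq_zero h,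
    Finset.sum_const_zero, mul_zero, add_zero, neg_zero]

/-- All derivatives fall on the smooth state, so this applies to a `v` not yet known to be weakly
differentiable. -/
theorem inner_waveOperator_ofSmooth {f g : E → ℝ → ℝ} (hf : ∀ k, ContDiff ℝ ∞ (f k))
    (hg : ∀ k, ContDiff ℝ ∞ (g k)) (h : N.ofSmooth f g hf hg ∈ N.waveOperator.domain)
    (v : N.StateSpace) :
    ⟪N.waveOperator ⟨_, h⟩, v⟫_ℝ = -(N.c ^ 2 * ∑ k, N.diam k ^ 2 *
      ((∫ x in Ioo 0 (N.length k), deriv (g k) x * pressure v k x)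
        + ∫ x in Ioo 0 (N.length k), deriv (f k) x * flux v k x)) := by
  have hw := N.isWeakImage_waveOperator ⟨_, h⟩
  rw [inner_eq, Finset.mul_sum, ← Finset.sum_neg_distrib]
  refine Finset.sum_congr rfl fun k _ => ?_
  have h1 := (hw.pressure k).ae_eq (WeightedL2.memLp (N.qWeight_pos k) _).neg
    (memLp_deriv (hf k) _) (N.hasWeakDeriv_pressure_ofSmooth hf hg k)
  have h2 := (hw.flux k).ae_eq ((WeightedL2.memLp (N.pWeight_pos k) _).const_mul _).neg
    (memLp_deriv (hg k) _) (N.hasWeakDeriv_flux_ofSmooth hf hg k)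
  have e1 : ∫ x in Ioo 0 (N.length k), flux (N.waveOperator ⟨_, h⟩) k x * flux v k x
      = -∫ x in Ioo 0 (N.length k), deriv (f k) x * flux v k x := by
    rw [← integral_neg]
    refine integral_congr_ae ?_
    filter_upwards [h1] with x hx
    rw [← hx, Pi.neg_apply, neg_mul, neg_neg]
  have e2 : ∫ x in Ioo 0 (N.length k), pressure (N.waveOperator ⟨_, h⟩) k x * pressure v k x
      = -(N.c ^ 2 * ∫ x in Ioo 0 (N.length k), deriv (g k) x * pressure v k x) := by
    rw [← integral_const_mul, ← integral_neg]
    refine integral_congr_ae ?_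
    filter_upwards [h2] with x hx
    rw [← hx, Pi.neg_apply, neg_mul, mul_neg, neg_neg, mul_assoc, mul_inv_cancel_left₀ (pow_pos N.c_pos 2).ne']
  rw [e1, e2]
  simp only [pWeight, qWeight]
  ring

/-! ### The adjoint -/

section Adjoint

variable {N} {v w : N.StateSpace}
  (H : ∀ u : N.waveOperator.domain, ⟪N.waveOperator u, v⟫_ℝ = -⟪(u : N.StateSpace), w⟫_ℝ)

include H

theorem isWeakImage_of_forall_inner : N.IsWeakImage v w := by
  classical
  have h0 : ContDiff ℝ ∞ (0 : ℝ → ℝ) := contDiff_const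
  have d0 : deriv (0 : ℝ → ℝ) = 0 := by ext; simp
  have hc := (pow_pos N.c_pos 2).ne'
  refine ⟨fun k φ h1 h2 h3 => ?_, fun k φ h1 h2 h3 => ?_⟩
  · have hmem := N.ofSmooth_mem_waveDomain (fun _ => h0) (contDiff_single h1 k)
      (N.nodeConditions_of_eq_zero (fun _ => rfl) (fun _ => rfl)
        (fun j => (N.single_apply_endpoints h3 j).1) (fun j => (N.single_apply_endpoints h3 j).2))
    have h := (N.inner_waveOperator_ofSmooth (fun _ => h0) (contDiff_single h1 k) hmem v).symm.trans
      ((H ⟨_, hmem⟩).trans (congrArg Neg.neg (N.inner_ofSmooth (fun _ => h0) (contDiff_single h1 k) w)))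
    rw [Finset.sum_eq_single k (fun j _ hj => by simp [hj, d0]) (by simp),
      Finset.sum_eq_single k (fun j _ hj => by simp [hj]) (by simp)] at h
    simp only [Pi.single_eq_same, d0, Pi.zero_apply, zero_mul, integral_zero, mul_zero, zero_add,
      add_zero, qWeight] at h
    have h' : N.c ^ 2 * (N.diam k ^ 2 * ∫ x in Ioo 0 (N.length k), deriv φ x * pressure v k x)
      = N.diam k ^ 2 * N.c ^ 2 * ∫ x in Ioo 0 (N.length k), φ x * flux w k x := neg_injective h
    rw [← mul_assoc, mul_comm (N.diam k ^ 2)] at h'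
    simp only [neg_mul, integral_neg, neg_neg]
    simp only [mul_comm _ (φ _), mul_comm _ (deriv φ _)]
    exact mul_left_cancel₀ (mul_ne_zero hc (pow_pos (N.diam_pos k) 2).ne') h'
  · have hmem := N.ofSmooth_mem_waveDomain (contDiff_single h1 k) (fun _ => h0)
      (N.nodeConditions_of_eq_zero (fun j => (N.single_apply_endpoints h3 j).1)
        (fun j => (N.single_apply_endpoints h3 j).2) (fun _ => rfl) (fun _ => rfl))
    have h := (N.inner_waveOperator_ofSmooth (contDiff_single h1 k) (fun _ => h0) hmem v).symm.trans
      ((H ⟨_, hmem⟩).trans (congrArg Neg.neg (N.inner_ofSmooth (contDiff_single h1 k) (fun _ => h0) w)))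
    rw [Finset.sum_eq_single k (fun j _ hj => by simp [hj, d0]) (by simp),
      Finset.sum_eq_single k (fun j _ hj => by simp [hj]) (by simp)] at h
    simp only [Pi.single_eq_same, d0, Pi.zero_apply, zero_mul, integral_zero, mul_zero, zero_add,
      add_zero, pWeight] at h
    have h' : N.c ^ 2 * (N.diam k ^ 2 * ∫ x in Ioo 0 (N.length k), deriv φ x * flux v k x)
      = N.diam k ^ 2 * ∫ x in Ioo 0 (N.length k), φ x * pressure w k x := neg_injective h
    rw [mul_left_comm] at h'
    have h'' := mul_left_cancel₀ (pow_pos (N.diam_pos k) 2).ne' h'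
    simp only [neg_mul, integral_neg, neg_neg, mul_assoc, integral_const_mul]
    simp only [mul_comm _ (φ _), mul_comm _ (deriv φ _)]
    rw [← h'', inv_mul_cancel_left₀ hc]

variable {p q : E → ℝ → ℝ} (hp : ∀ k, IsContRep (N.length k) (pressure v k) (p k))
  (hq : ∀ k, IsContRep (N.length k) (flux v k) (q k))

include hp hq

/-- Data admissible at `x`, extended affinely with value zero at all other nodes, define an element
of the domain. Green's formula against `v` then retains only the contribution of `x`. -/
theorem sum_node_eq_zero [Finite V] {x : V} {a b : E → ℝ}
    (h1 : ∀ k, N.source k = x → N.IsEntry x → a k = 0)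
    (h2 : ∀ k, N.target k = x → N.IsExit x → b k = 0)
    (h3 : N.IsInterior x → ∀ j k, N.xi j x ≠ 0 → N.xi k x ≠ 0 → a j = a k)
    (h4 : N.IsInterior x → ∑ k, N.xi k x * N.diam k ^ 2 * b k = 0) :
    ∑ k, N.xi k x * (N.diam k ^ 2 *
      (a k * N.nodeValue (q k) k x + N.nodeValue (p k) k x * b k)) = 0 := by
  classical
  cases nonempty_fintype V
  have hnc := N.nodeConditions_affine (a := fun k => Pi.single x (a k))
    (b := fun k => Pi.single x (b k))
    (fun k hk => by
      by_cases h : N.source k = x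
      · rw [h] at hk ⊢
        simp [h1 k h hk]
      · simp [h])
    (fun k hk => by
      by_cases h : N.target k = x
      · rw [h] at hk ⊢
        simp [h2 k h hk]
      · simp [h])
    (fun y hy j k hj hk => by
      by_cases h : y = x
      · subst h
        simp [h3 hy j k hj hk]
      · simp [h])
    (fun y hy => by
      by_cases h : y = x
      · subst h
        simpa using h4 hy
      · simp [h])
  have ha : ∀ k, ContDiff ℝ ∞ (N.affine (Pi.single x (a k)) k) := fun k => N.contDiff_affine _ k
  have hb : ∀ k, ContDiff ℝ ∞ (N.affine (Pi.single x (b k)) k) := fun k => N.contDiff_affine _ k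
  have hmem := N.ofSmooth_mem_waveDomain ha hb hnc
  have hg := (N.isWeakImage_waveOperator ⟨_, hmem⟩).inner_add_inner (isWeakImage_of_forall_inner H)
    (N.isContRep_pressure_ofSmooth ha hb) (N.isContRep_flux_ofSmooth ha hb) hp hq
  rw [H, neg_add_cancel, eq_comm, neg_eq_zero, mul_eq_zero,
    or_iff_right (pow_pos N.c_pos 2).ne'] at hg
  simp only [mul_add _ (_ - _), Finset.sum_add_distrib, sum_boundary] at hg
  rw [← Finset.sum_add_distrib, Finset.sum_eq_single x] at hg
  · rw [← hg, ← Finset.sum_add_distrib]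
    refine Finset.sum_congr rfl fun k _ => ?_
    by_cases hk : N.xi k x = 0
    · simp [hk]
    · rw [N.nodeValue_affine _ hk, N.nodeValue_affine _ hk, Pi.single_eq_same, Pi.single_eq_same]
      ring
  · intro y _ hy
    rw [← Finset.sum_add_distrib]
    refine Finset.sum_eq_zero fun k _ => ?_
    by_cases hk : N.xi k y = 0
    · simp [hk]
    · rw [N.nodeValue_affine _ hk, N.nodeValue_affine _ hk, Pi.single_eq_of_ne hy,
        Pi.single_eq_of_ne hy]
      ring
  · simp

theorem nodeConditions_of_forall_inner [Finite V] : N.NodeConditions p q := by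
  classical
  have hD : ∀ k, N.diam k ^ 2 ≠ 0 := fun k => (pow_pos (N.diam_pos k) 2).ne'
  -- A node where one pipe starts and another ends is interior, so at an entry node the exit
  -- constraint on the data is vacuous, and conversely.
  have hnot : ∀ j k, N.source j = N.target k → N.IsInterior (N.target k) := fun j k h => by
    refine N.isInterior_of_ne (j := j) (k := k) ?_ ?_ ?_
    · rw [← h, xi_source]; norm_num
    · rw [xi_target]; norm_num
    · rintro rfl
      exact N.source_ne_target _ h
  have hsingle : ∀ k x, N.xi k x ≠ 0 → ¬ N.IsInterior x → ∀ j, j ≠ k → N.xi j x = 0 :=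
    fun k x hk hx j hj => by
      by_contra h
      exact hx (N.isInterior_of_ne h hk hj)
  refine ⟨fun k hk => ?_, fun k hk => ?_, fun x hx j k hj hk => ?_, fun x hx => ?_⟩
  · have hxi : N.xi k (N.source k) ≠ 0 := by rw [xi_source]; norm_num
    -- The flux is unconstrained at an entry node; unit flux detects the pressure of `v`. At an exit
    -- node the roles are exchanged.
    have h := sum_node_eq_zero H hp hq (x := N.source k) (a := 0) (b := 1)
      (fun _ _ _ => rfl) (fun j hj _ => absurd (hj ▸ hnot k j hj.symm) hk.1)
      (fun hx => absurd hx hk.1) (fun hx => absurd hx hk.1)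
    rw [Finset.sum_eq_single k (fun j _ hj => by simp [hsingle k _ hxi hk.1 j hj])
      (by simp)] at h
    simpa [xi_source, hD] using h
  · have hxi : N.xi k (N.target k) ≠ 0 := by rw [xi_target]; norm_num
    have h := sum_node_eq_zero H hp hq (x := N.target k) (a := 1) (b := 0)
      (fun j hj _ => absurd (hnot j k hj) hk.1) (fun _ _ _ => rfl)
      (fun hx => absurd hx hk.1) (fun hx => absurd hx hk.1)
    rw [Finset.sum_eq_single k (fun j _ hj => by simp [hsingle k _ hxi hk.1 j hj])
      (by simp)] at h
    simpa [xi_target, hD] using h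
  · have hcalc : ∀ i (r : ℝ), N.xi i x ≠ 0 →
        N.xi i x * (N.diam i ^ 2 * (r * (N.xi i x / N.diam i ^ 2))) = r := fun i r hi => by
      have := N.xi_mul_self hi
      have := (N.diam_pos i).ne'
      field_simp
      linear_combination r * N.xi_mul_self hi
    have hcalc' : ∀ i, N.xi i x ≠ 0 →
        N.xi i x * N.diam i ^ 2 * (N.xi i x / N.diam i ^ 2) = 1 := fun i hi => by
      simpa [mul_assoc] using hcalc i 1 hi
    -- Opposite unit contributions to Kirchhoff's sum from pipes `j` and `k`: the data are balanced,
    -- and the node sum becomes the difference of the two pressures of `v`.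
    have h := sum_node_eq_zero H hp hq (x := x) (a := 0)
      (b := Pi.single j (N.xi j x / N.diam j ^ 2) - Pi.single k (N.xi k x / N.diam k ^ 2))
      (fun _ _ _ => rfl) (fun i _ hi => absurd hx hi.1) (fun _ _ _ _ _ => rfl)
      (fun _ => by
        simp only [Pi.sub_apply, mul_sub, Finset.sum_sub_distrib]
        rw [Finset.sum_eq_single j (fun i _ hi => by simp [hi]) (by simp),
          Finset.sum_eq_single k (fun i _ hi => by simp [hi]) (by simp),
          Pi.single_eq_same, Pi.single_eq_same, hcalc' j hj, hcalc' k hk, sub_self])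
    simp only [Pi.zero_apply, zero_mul, zero_add, Pi.sub_apply, mul_sub,
      Finset.sum_sub_distrib] at h
    rw [Finset.sum_eq_single j (fun i _ hi => by simp [hi]) (by simp),
      Finset.sum_eq_single k (fun i _ hi => by simp [hi]) (by simp),
      Pi.single_eq_same, Pi.single_eq_same, hcalc j _ hj, hcalc k _ hk] at h
    exact sub_eq_zero.1 h
  -- Constant pressure one without flux turns the node sum into Kirchhoff's sum for `v`.
  · have h := sum_node_eq_zero H hp hq (x := x) (a := 1) (b := 0)
      (fun j _ hj => absurd hx hj.1) (fun _ _ _ => rfl) (fun _ _ _ _ _ => rfl)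
      (fun _ => by simp)
    simpa [mul_assoc] using h

omit hp hq

theorem mem_waveDomain_of_forall_inner [Finite V] : v ∈ N.waveDomain := by
  have hw := isWeakImage_of_forall_inner H
  choose p hp using fun k => (hw.pressure k).exists_isContRep (N.length_pos k)
    (WeightedL2.memLp (N.pWeight_pos k) _) (WeightedL2.memLp (N.qWeight_pos k) _).neg
  choose q hq using fun k => (hw.flux k).exists_isContRep (N.length_pos k)
    (WeightedL2.memLp (N.qWeight_pos k) _) ((WeightedL2.memLp (N.pWeight_pos k) _).const_mul _).neg
  exact ⟨fun k => (hw.mem_sobolevH1 k).1, fun k => (hw.mem_sobolevH1 k).2, p, q, hp, hq,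
    nodeConditions_of_forall_inner H hp hq⟩

end Adjoint

theorem isSkewAdjointOperator_waveOperator [Finite V] : IsSkewAdjointOperator N.waveOperator :=
  isSkewAdjointOperator_of_le N.dense_waveDomain N.waveOperator_skew fun v w h =>
    mem_waveDomain_of_forall_inner (w := -w) fun u => by rw [inner_neg_right, neg_neg, h u]

end PipeNetwork

theorem theorem3p1 {V E : Type*} [Finite V] [Fintype E] (N : PipeNetwork V E) :
    IsMaximalDissipative N.waveOperator ∧
    IsSkewAdjointOperator N.waveOperator ∧
    ∃ T : ℝ → N.StateSpace →L[ℝ] N.StateSpace,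
      IsC0Group T ∧ (∀ t, Isometry (T t)) ∧ IsGenerator N.waveOperator T :=
  have h := N.isSkewAdjointOperator_waveOperator
  ⟨h.isMaximalDissipative, h, h.exists_group⟩
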